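/- **Setting.** Let $d\in\mathbb N$, $\vec\alpha\in\mathbb R^d$, $\|\vec\alpha\|_1=\sum_j|\alpha_j|$, $\|\vec\alpha\|_\infty=\max_j|\alpha_j|$, and let $t>0$. A protocol of duration $t$ consists of finitely many ancilla qubits, a pure initial probe state $|\psi(0)\rangle$ of the $d$ sensor qubits and the ancillas, and a control that does not depend on the parameters: a Hermitian, integrable, otherwise arbitrary time-dependent Hamiltonian $\hat H_c(s)$, $s\in[0,t]$, together with finitely many instantaneous unitary gates, all acting on sensors and ancillas. For parameters $\vec\theta\in\mathbb R^d$ let $\hat U(s)$ be the unitary propagator generated by $$\hat H(s)=\sum_{i=1}^d\tfrac12\theta_i\hat\sigma^z_i+\hat H_c(s)$$ and the gates, $|\psi(s)\rangle=\hat U(s)|\psi(0)\rangle$, and $\hat{\mathcal H}_j=-\int_0^t\hat U^\dagger(s)\,\tfrac12\hat\sigma_j^z\,\hat U(s)\,ds$. The quantum Fisher information matrix is $$\mathcal F(\vec\theta)_{ij}=4\Big[\tfrac12\langle\{\hat{\mathcal H}_i,\hat{\mathcal H}_j\}\rangle-\langle\hat{\mathcal H}_i\rangle\langle\hat{\mathcal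 H}_j\rangle\Big],$$ with expectation values in $|\psi(0)\rangle$. The protocol is *optimal* at $\vec\theta$ for estimating $q(\vec\theta)=\vec\alpha\cdot\vec\theta$ (it saturates the quantum Cramér–Rao bound $\|\vec\alpha\|_\infty^2/t^2$) if there are weights $\lambda_i\ge0$ with $\sum_i\lambda_i=1$ and $\lambda_i=0$ whenever $|\alpha_i|\neq\|\vec\alpha\|_\infty$, such that $$\sum_i\lambda_i\,\mathrm{sgn}(\alpha_i)\,\mathcal F(\vec\theta)_{ji}=\frac{\alpha_j}{\|\vec\alpha\|_\infty}t^2\qquad\text{for all } j.$$ If $|\alpha_1|>|\alpha_j|$ for all $j>1$, this is the condition $\mathcal F(\vec\theta)_{1j}=\frac{\alpha_j}{\alpha_1}t^2$ for all $j$. A pure state has *at most $m$-partite entanglement* if the qubits can be partitioned into blocks, each with at most $m$ sensor qubits (ancillas are not counted), such that the state is a product of one state per block. **Theorem.** Let $k$ be a positive integer with $$k-1<\frac{\|\vec\alpha\|_1}{\|\vec\alpha\|_\infty}\le k .$$ Then an optimal protocol requires at least, but no more than, $k$-partite entanglement: 1. If a protocol is optimal at some $\vec\theta$, and if for this $\vec\theta$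 the state $|\psi(s)\rangle$ has at most $m$-partite entanglement for almost every $s\in[0,t]$, then $m\ge k$. 2. There is a protocol without ancillas that is optimal at every $\vec\theta\in\mathbb R^d$ and whose state has at most $k$-partite entanglement at every time, for every $\vec\theta$. -/

import Mathlib

open scoped Matrix

noncomputable section

namespace SensorNetwork

/-- Computational basis labels of `d` sensor qubits together with `n` ancilla qubits. -/
abbrev Config (d n : ℕ) : Type := Fin d ⊕ Fin n → Fin 2

/-- (Not necessarily normalized) vectors of the `(d + n)`-qubit Hilbert space, in coordinates. -/
abbrev Ket (d n : ℕ) : Type := Config d n → ℂ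

/-- Operators on the `(d + n)`-qubit Hilbert space. -/
abbrev Op (d n : ℕ) : Type := Matrix (Config d n) (Config d n) ℂ

/-- Unitary operators on the `(d + n)`-qubit Hilbert space. -/
abbrev UnitaryOp (d n : ℕ) : Type := Matrix.unitaryGroup (Config d n) ℂ

/-- The Pauli operator `σᶻ` acting on the sensor qubit `j`. -/
def sigmaZ {d : ℕ} (n : ℕ) (j : Fin d) : Op d n :=
  Matrix.diagonal fun c => if c (Sum.inl j) = 0 then 1 else -1

/-- The generator `∂H/∂θ_j = σᶻ_j / 2`. -/
def generator {d : ℕ} (n : ℕ) (j : Fin d) : Op d n :=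
  (1 / 2 : ℂ) • sigmaZ n j

/-- The expectation value `⟨ψ| A |ψ⟩`; it is used for Hermitian `A` only, where it is real. -/
def expectation {d n : ℕ} (ψ : Ket d n) (A : Op d n) : ℝ :=
  (star ψ ⬝ᵥ (A *ᵥ ψ)).re

/-- The pure state `ψ` of `d` sensor qubits and `n` ancilla qubits has at most `m`-partite
entanglement: the qubits can be partitioned into blocks (`b q` is the label of the block of the
qubit `q`), each with at most `m` sensor qubits, such that `ψ` is a product of one vector per block.
Ancilla qubits may sit in any block and are not counted; without ancillas this is the usual notion
of an `m`-producible pure state. -/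
def Producible {d n : ℕ} (m : ℕ) (ψ : Ket d n) : Prop :=
  ∃ (r : ℕ) (b : Fin d ⊕ Fin n → Fin r) (φ : (β : Fin r) → ({q // b q = β} → Fin 2) → ℂ),
    (∀ β, (Finset.univ.filter fun j : Fin d => b (Sum.inl j) = β).card ≤ m) ∧
    ∀ c, ψ c = ∏ β, φ β fun q => c q

/-- A (parameter-independent) choice of ancillas, pure probe state and controls for sensing with
`d` qubits during the time `t`. The control consists of a Hermitian, integrable, otherwise
arbitrary time-dependent Hamiltonian and of finitely many instantaneous unitary gates (impulses)
applied at the times `time 1 ≤ … ≤ time numGates`, where `0 = time 0` and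
`time (numGates + 1) = t`. Several gates may be applied at the same time. All of them may act on
the ancillas. -/
structure Protocol (d : ℕ) (t : ℝ) where
  /-- number of ancilla qubits -/
  numAncilla : ℕ
  /-- the initial probe state -/
  probe : Ket d numAncilla
  probe_unit : star probe ⬝ᵥ probe = 1
  /-- number of instantaneous gates -/
  numGates : ℕ
  /-- start, gate times, end -/
  time : Fin (numGates + 2) → ℝ
  time_mono : Monotone time
  time_zero : time 0 = 0
  time_last : time (Fin.last (numGates + 1)) = t
  /-- the gates -/
  gate : Fin numGates → UnitaryOp d numAncilla
  /-- the control Hamiltonian -/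
  control : ℝ → Op d numAncilla
  control_hermitian : ∀ s, (control s).IsHermitian
  control_integrable : ∀ a b,
    IntervalIntegrable (fun s => control s a b) MeasureTheory.volume 0 t

namespace Protocol

variable {d : ℕ} {t : ℝ}

/-- The `l`-th time segment, between two consecutive gates. -/
def segment (P : Protocol d t) (l : Fin (P.numGates + 1)) : Set ℝ :=
  Set.Icc (P.time l.castSucc) (P.time l.succ)

/-- The Hamiltonian `H(s) = ∑ θ_j σᶻ_j / 2 + H_c(s)`. -/
def hamiltonian (P : Protocol d t) (θ : Fin d → ℝ) (s : ℝ) : Op d P.numAncilla :=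
  (∑ j, (θ j : ℂ) • generator P.numAncilla j) + P.control s

/-- `U l s` is the unitary propagator from time `0` to the time `s` in the `l`-th segment, for the
parameter values `θ`: it starts at the identity, solves `dU/ds = -i H(s) U` (as an integral
equation, entry by entry) inside each segment, and is multiplied by the gate between two
segments. -/
structure IsEvolution (P : Protocol d t) (θ : Fin d → ℝ)
    (U : Fin (P.numGates + 1) → ℝ → UnitaryOp d P.numAncilla) : Prop where
  continuousOn : ∀ l, ContinuousOn (fun s => (U l s : Op d P.numAncilla)) (P.segment l)
  start : U 0 0 = 1
  jump : ∀ l : Fin P.numGates,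
    U l.succ (P.time l.castSucc.succ) = P.gate l * U l.castSucc (P.time l.castSucc.succ)
  schrodinger : ∀ l, ∀ s ∈ P.segment l, ∀ a b,
    (U l s : Op d P.numAncilla) a b = (U l (P.time l.castSucc) : Op d P.numAncilla) a b -
      Complex.I * ∫ r in (P.time l.castSucc)..s,
        (P.hamiltonian θ r * (U l r : Op d P.numAncilla)) a b

/-- The time-evolved generator `𝓗_j(t) = -∫₀ᵗ U†(s) (σᶻ_j / 2) U(s) ds`. -/
def evolvedGenerator (P : Protocol d t)
    (U : Fin (P.numGates + 1) → ℝ → UnitaryOp d P.numAncilla) (j : Fin d) :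
    Op d P.numAncilla :=
  Matrix.of fun a b => -∑ l, ∫ s in (P.time l.castSucc)..(P.time l.succ),
    ((U l s : Op d P.numAncilla)ᴴ * generator P.numAncilla j * (U l s : Op d P.numAncilla)) a b

/-- The quantum Fisher information matrix
`F_ij = 4 (⟨{𝓗_i, 𝓗_j}⟩ / 2 - ⟨𝓗_i⟩ ⟨𝓗_j⟩)` in the probe state. -/
def fisher (P : Protocol d t)
    (U : Fin (P.numGates + 1) → ℝ → UnitaryOp d P.numAncilla) : Matrix (Fin d) (Fin d) ℝ :=
  Matrix.of fun i j =>
    4 * (1 / 2 * expectation P.probe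
          (P.evolvedGenerator U i * P.evolvedGenerator U j +
            P.evolvedGenerator U j * P.evolvedGenerator U i) -
        expectation P.probe (P.evolvedGenerator U i) *
          expectation P.probe (P.evolvedGenerator U j))

/-- Optimality of the protocol for estimating `α · θ`: saturation of the quantum Cramér–Rao bound
`‖α‖∞² / t²`, that is, for some weights `lam` on the set of the indices `i` with `|α_i| = ‖α‖∞`,
`∑_i lam_i sgn(α_i) F_ji = t² α_j / ‖α‖∞` for all `j`. (`‖α‖` is the sup norm of `α`.) If `|α_i|`
is maximal for `i = i₁` only, this says `F_{i₁ j} = (α_j / α_{i₁}) t²` for all `j`, see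
`isOptimal_iff_of_forall_lt`. -/
def IsOptimal (P : Protocol d t) (α : Fin d → ℝ)
    (U : Fin (P.numGates + 1) → ℝ → UnitaryOp d P.numAncilla) : Prop :=
  ∃ lam : Fin d → ℝ, (∀ i, 0 ≤ lam i) ∧ (∀ i, |α i| ≠ ‖α‖ → lam i = 0) ∧ ∑ i, lam i = 1 ∧
    ∀ j, ∑ i, lam i * Real.sign (α i) * P.fisher U j i = t ^ 2 / ‖α‖ * α j

/-- At every time of the protocol (also between gates applied at the same time) the state has at
most `m`-partite entanglement. -/
def EntanglementAtMost (P : Protocol d t) (m : ℕ)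
    (U : Fin (P.numGates + 1) → ℝ → UnitaryOp d P.numAncilla) : Prop :=
  ∀ l, ∀ s ∈ P.segment l, Producible m ((U l s : Op d P.numAncilla) *ᵥ P.probe)

/-- At almost every time of the protocol the state has at most `m`-partite entanglement. -/
def EntanglementAtMostAE (P : Protocol d t) (m : ℕ)
    (U : Fin (P.numGates + 1) → ℝ → UnitaryOp d P.numAncilla) : Prop :=
  ∀ l, ∀ᵐ s ∂(MeasureTheory.volume.restrict (P.segment l)),
    Producible m ((U l s : Op d P.numAncilla) *ᵥ P.probe)

theorem fisher_symm (P : Protocol d t)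
    (U : Fin (P.numGates + 1) → ℝ → UnitaryOp d P.numAncilla) (i j : Fin d) :
    P.fisher U i j = P.fisher U j i := by
  simp only [fisher, Matrix.of_apply]
  rw [add_comm (P.evolvedGenerator U i * P.evolvedGenerator U j),
    mul_comm (expectation P.probe (P.evolvedGenerator U i))]

theorem isOptimal_iff_of_forall_lt (P : Protocol d t) (α : Fin d → ℝ)
    (U : Fin (P.numGates + 1) → ℝ → UnitaryOp d P.numAncilla) (i₁ : Fin d)
    (h0 : α i₁ ≠ 0) (h : ∀ j, j ≠ i₁ → |α j| < |α i₁|) :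
    P.IsOptimal α U ↔ ∀ j, P.fisher U i₁ j = α j / α i₁ * t ^ 2 := by
  have hn : ‖α‖ = |α i₁| := by
    apply le_antisymm
    · refine (pi_norm_le_iff_of_nonneg (abs_nonneg _)).2 fun j => ?_
      by_cases hj : j = i₁
      · simp [hj]
      · simpa using (h j hj).le
    · simpa using norm_le_pi_norm α i₁
  have key : ∀ j, (Real.sign (α i₁) * P.fisher U j i₁ = t ^ 2 / ‖α‖ * α j ↔
      P.fisher U i₁ j = α j / α i₁ * t ^ 2) := by
    intro j
    rw [P.fisher_symm U i₁ j, hn]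
    rcases lt_or_gt_of_ne h0 with hneg | hpos
    · rw [Real.sign_of_neg hneg, abs_of_neg hneg]
      constructor
      · intro e
        have e2 : P.fisher U j i₁ = -(t ^ 2 / -α i₁ * α j) := by linarith
        rw [e2]; field_simp
      · intro e
        rw [e]; field_simp
    · rw [Real.sign_of_pos hpos, abs_of_pos hpos, one_mul]
      constructor
      · intro e
        rw [e]; field_simp
      · intro e
        rw [e]; field_simp
  constructor
  · rintro ⟨lam, -, hz, hs, hF⟩ j
    have hz2 : ∀ i, i ≠ i₁ → lam i = 0 := fun i hi => hz i (by rw [hn]; exact (h i hi).ne)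
    have h1 : lam i₁ = 1 := by
      rw [← hs, Finset.sum_eq_single i₁ (fun i _ hi => hz2 i hi) (by simp)]
    have := hF j
    rw [Finset.sum_eq_single i₁ (fun i _ hi => by simp [hz2 i hi]) (by simp), h1, one_mul] at this
    exact (key j).1 this
  · intro hF
    refine ⟨Pi.single i₁ 1, fun i => ?_, fun i hi => ?_, by simp, fun j => ?_⟩
    · by_cases hi : i = i₁
      · subst hi; simp
      · simp [hi]
    · have : i ≠ i₁ := fun e => hi (by rw [e, hn])
      simp [this]
    · rw [Finset.sum_eq_single i₁ (fun i _ hi => by simp [hi]) (by simp)]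
      simpa using (key j).2 (hF j)

end Protocol

end SensorNetwork

end

/-! Lower bound. With `w i = lam i * sgn (α i)`, put `g = ∑ w i σᶻ_i`, an observable with `|g| ≤ 1`,
and let `G` be the time integral of `U†(s) g U(s)`. Optimality says that `G` has covariance `t² α_j
/ ‖α‖∞` with the integrated `σᶻ_j`, hence `Var G = t²`. Since `‖G‖ ≤ t`, this variance is maximal,
and saturation is rigid (`ae_of_covariance_eq_sq`): `⟨G⟩ = 0`, and for almost every `s`, `G ψ(0) = t
U†(s) g ψ(s)` while `g = ±1` on the support of `ψ(s)`. Test `G` against `z = ∑ sgn (α j) σᶻ_j`: the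
covariance is `t² ‖α‖₁ / ‖α‖∞` by optimality, and `t ∫ ⟨g z⟩ ds` by rigidity. As `g` is an average
of signed spins, `g = ±1` forces it to agree there with one signed spin `i` of nonzero weight. That
spin has mean zero and, in a product of blocks, is uncorrelated with every qubit outside its own
block, so `⟨g z⟩ ≤ m` (`sum_correlation_le_of_producible`). Hence `‖α‖₁ / ‖α‖∞ ≤ m`. Of the
evolution only continuity and unitarity are used.

Construction. The vector `|α_j| / ‖α‖∞` lies in the unit cube cut by `∑ a_j ≤ k`. The vertices of
this polytope are indicators of sets of at most `k` qubits, so the vector is a convex combination of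
such indicators (`exists_schedule`). Its weights become fractions of the time `t`, during which the
probe is a cat state on the corresponding set. A qubit `i₀` with `|α_{i₀}|` maximal has coordinate
`1`, so it belongs to every set of positive weight; flips controlled by `i₀` turn one cat state into
another. Everything permutes the computational basis up to phases, and the phases drop out of the
Fisher matrix, so optimality holds for every `θ`. -/

noncomputable section

namespace SensorNetwork

open MeasureTheory

/-! ### Correlations of spins in product states -/

/-- The eigenvalue of `σᶻ_j` on a computational basis state. -/
def spin {d n : ℕ} (j : Fin d) (c : Config d n) : ℝ :=
  if c (Sum.inl j) = 0 then 1 else -1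

theorem abs_spin {d n : ℕ} (j : Fin d) (c : Config d n) : |spin j c| = 1 := by
  unfold spin; split_ifs <;> norm_num

theorem generator_eq_diagonal {d n : ℕ} (j : Fin d) :
    generator n j = (1 / 2 : ℂ) • Matrix.diagonal fun c : Config d n => (spin j c : ℂ) := by
  unfold generator sigmaZ spin
  congr 2
  ext c
  split_ifs <;> simp

/-- Replace the part of `c` in the block `β` by the corresponding part of `c'`. -/
def swapBlock {d n r : ℕ} (b : Fin d ⊕ Fin n → Fin r) (β : Fin r) (c c' : Config d n) :
    Config d n :=
  fun q => if b q = β then c' q else c q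

theorem swapBlock_swapBlock {d n r : ℕ} (b : Fin d ⊕ Fin n → Fin r) (β : Fin r)
    (c c' : Config d n) :
    swapBlock b β (swapBlock b β c c') (swapBlock b β c' c) = c := by
  ext q
  unfold swapBlock
  split_ifs <;> rfl

/-- Exchanging the block `β` between two copies of the system. -/
def swapEquiv {d n r : ℕ} (b : Fin d ⊕ Fin n → Fin r) (β : Fin r) :
    Config d n × Config d n ≃ Config d n × Config d n where
  toFun x := (swapBlock b β x.1 x.2, swapBlock b β x.2 x.1)
  invFun x := (swapBlock b β x.1 x.2, swapBlock b β x.2 x.1)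
  left_inv x := by simp [swapBlock_swapBlock]
  right_inv x := by simp [swapBlock_swapBlock]

/-- In `ψ c * ψ c'` every block contributes one factor from each copy; exchanging a block between
the copies merely exchanges its two factors. -/
theorem mul_swapBlock_of_product {d n r : ℕ} {b : Fin d ⊕ Fin n → Fin r}
    {φ : (β : Fin r) → ({q // b q = β} → Fin 2) → ℂ} {ψ : Ket d n}
    (hψ : ∀ c, ψ c = ∏ β, φ β fun q => c q) (β : Fin r) (c c' : Config d n) :
    ψ (swapBlock b β c c') * ψ (swapBlock b β c' c) = ψ c * ψ c' := by
  simp only [hψ, ← Finset.prod_mul_distrib]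
  refine Finset.prod_congr rfl fun γ _ => ?_
  by_cases h : γ = β
  · have e : ∀ x y : Config d n, (fun q : {q // b q = γ} => swapBlock b β x y q) =
        fun q : {q // b q = γ} => y q := by
      intro x y; ext q; simp [swapBlock, q.2, h]
    rw [e, e, mul_comm]
  · have e : ∀ x y : Config d n, (fun q : {q // b q = γ} => swapBlock b β x y q) =
        fun q : {q // b q = γ} => x q := by
      intro x y; ext q; simp [swapBlock, q.2, h]
    rw [e, e]

/-- Qubits in different blocks of a product state are uncorrelated. -/
theorem sum_spin_mul_spin_of_product {d n r : ℕ} {b : Fin d ⊕ Fin n → Fin r}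
    {φ : (β : Fin r) → ({q // b q = β} → Fin 2) → ℂ} {ψ : Ket d n}
    (hψ : ∀ c, ψ c = ∏ β, φ β fun q => c q) (i j : Fin d)
    (hij : b (Sum.inl j) ≠ b (Sum.inl i)) :
    (∑ c, spin i c * spin j c * Complex.normSq (ψ c)) * ∑ c, Complex.normSq (ψ c) =
      (∑ c, spin i c * Complex.normSq (ψ c)) * ∑ c, spin j c * Complex.normSq (ψ c) := by
  -- Both sides become sums over two copies of the system. Exchanging the block of `j` moves the
  -- spin of `j` to the second copy and leaves the spin of `i` and the product weight unchanged.
  rw [Finset.sum_mul_sum, Finset.sum_mul_sum, ← Finset.sum_product', ← Finset.sum_product',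
    Finset.univ_product_univ, ← (swapEquiv b (b (Sum.inl j))).sum_comp]
  refine Finset.sum_congr rfl fun x _ => ?_
  have h1 : spin i (swapBlock b (b (Sum.inl j)) x.1 x.2) = spin i x.1 := by
    simp [spin, swapBlock, hij.symm]
  have h2 : spin j (swapBlock b (b (Sum.inl j)) x.1 x.2) = spin j x.2 := by
    simp [spin, swapBlock]
  have h3 := congrArg Complex.normSq (mul_swapBlock_of_product hψ (b (Sum.inl j)) x.1 x.2)
  simp only [map_mul] at h3
  simp only [swapEquiv, Equiv.coe_fn_mk, h1, h2]
  linear_combination (spin i x.1 * spin j x.2) * h3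

/-- The equality case of the triangle inequality: if the sum is `ε = ±1`, the nonnegative numbers
`|w j| - ε * (w j * spin j c)` add up to zero, so each of them vanishes. -/
theorem eq_sign_mul_of_sq_sum_eq_one {d n : ℕ} {w : Fin d → ℝ} (hw : ∑ i, |w i| = 1)
    {i : Fin d} (hi : w i ≠ 0) {c : Config d n} (hc : (∑ j, w j * spin j c) ^ 2 = 1) :
    ∑ j, w j * spin j c = Real.sign (w i) * spin i c := by
  have hb : ∀ ε : ℝ, |ε| = 1 → ∀ j, 0 ≤ |w j| - ε * (w j * spin j c) := by
    intro ε hε j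
    have := le_abs_self (ε * (w j * spin j c))
    rw [abs_mul, abs_mul, abs_spin, hε] at this
    linarith
  have key : ∀ ε : ℝ, |ε| = 1 → ε * ε = 1 → ∑ j, w j * spin j c = ε →
      ε = Real.sign (w i) * spin i c := by
    intro ε h1 h2 h3
    have h4 : ∑ j, (|w j| - ε * (w j * spin j c)) = 0 := by
      rw [Finset.sum_sub_distrib, ← Finset.mul_sum, h3, hw, h2, sub_self]
    have h5 := (Finset.sum_eq_zero_iff_of_nonneg fun j _ => hb ε h1 j).1 h4 i (Finset.mem_univ i)
    have h6 : |w i| * ε = w i * spin i c := by linear_combination ε * h5 + w i * spin i c * h2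
    rcases lt_or_gt_of_ne hi with h | h
    · rw [Real.sign_of_neg h]
      rw [abs_of_neg h] at h6
      exact mul_left_cancel₀ hi (by linarith)
    · rw [Real.sign_of_pos h]
      rw [abs_of_pos h] at h6
      exact mul_left_cancel₀ hi (by linarith)
  rcases mul_self_eq_one_iff.1 ((sq _).symm.trans hc) with h | h
  · rw [h]; exact key 1 (by simp) (by simp) h
  · rw [h]; exact key (-1) (by simp) (by simp) h

/-- If a weighted magnetization takes only its extreme values in a product state, with mean zero,
then its correlations with the individual qubits are confined to one block. -/
theorem sum_correlation_le_of_producible {d n m : ℕ} {ψ : Ket d n} (hp : Producible m ψ)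
    {w τ : Fin d → ℝ} (hw : ∑ i, |w i| = 1) (hτ : ∀ i, |τ i| ≤ 1)
    (h1 : ∑ c, Complex.normSq (ψ c) = 1)
    (h2 : ∑ c, (1 - (∑ j, w j * spin j c) ^ 2) * Complex.normSq (ψ c) = 0)
    (h0 : ∑ c, (∑ j, w j * spin j c) * Complex.normSq (ψ c) = 0) :
    ∑ c, (∑ j, w j * spin j c) * (∑ j, τ j * spin j c) * Complex.normSq (ψ c) ≤ m := by
  obtain ⟨r, b, φ, hm, hψ⟩ := hp
  obtain ⟨i, hi⟩ : ∃ i, w i ≠ 0 := by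
    by_contra! h
    simp [h] at hw
  have hle : ∀ c : Config d n, (∑ j, w j * spin j c) ^ 2 ≤ 1 := by
    intro c
    rw [sq_le_one_iff_abs_le_one, ← hw]
    refine (Finset.abs_sum_le_sum_abs _ _).trans (Finset.sum_le_sum fun j _ => ?_)
    rw [abs_mul, abs_spin, mul_one]
  -- By `h2` the magnetization is `±1` wherever the amplitude is nonzero, hence equals the signed
  -- spin of `i` there; elsewhere both sides are zero.
  have hg : ∀ c : Config d n, (∑ j, w j * spin j c) * Complex.normSq (ψ c) =
      Real.sign (w i) * spin i c * Complex.normSq (ψ c) := by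
    intro c
    have := (Finset.sum_eq_zero_iff_of_nonneg fun c _ =>
      mul_nonneg (sub_nonneg.2 (hle c)) (Complex.normSq_nonneg (ψ c))).1 h2 c (Finset.mem_univ c)
    rcases mul_eq_zero.1 this with h | h
    · rw [eq_sign_mul_of_sq_sum_eq_one hw hi (by linarith)]
    · rw [h]; simp
  have hs : |Real.sign (w i)| = 1 := by
    rcases lt_or_gt_of_ne hi with h | h
    · simp [Real.sign_of_neg h]
    · simp [Real.sign_of_pos h]
  have hs0 : Real.sign (w i) ≠ 0 := by
    intro h; simp [h] at hs
  have hmean : ∑ c, spin i c * Complex.normSq (ψ c) = 0 := by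
    simp only [hg, mul_assoc, ← Finset.mul_sum] at h0
    exact (mul_eq_zero.1 h0).resolve_left hs0
  calc ∑ c, (∑ j, w j * spin j c) * (∑ j, τ j * spin j c) * Complex.normSq (ψ c)
      = ∑ j, ∑ c, Real.sign (w i) * τ j * (spin i c * spin j c * Complex.normSq (ψ c)) := by
        rw [Finset.sum_comm]
        refine Finset.sum_congr rfl fun c _ => ?_
        rw [mul_right_comm, hg, Finset.mul_sum]
        exact Finset.sum_congr rfl fun j _ => by ring
    -- A qubit in the block of `i` contributes at most `1`. One outside is uncorrelated with `i`,
    -- whose mean is zero, and contributes nothing.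
    _ ≤ ∑ j, if b (Sum.inl j) = b (Sum.inl i) then (1 : ℝ) else 0 := by
        refine Finset.sum_le_sum fun j _ => ?_
        split_ifs with h
        · rw [← h1]
          refine Finset.sum_le_sum fun c _ => ?_
          refine (le_abs_self _).trans ?_
          rw [abs_mul, abs_mul, abs_mul, abs_mul, abs_spin, abs_spin, hs,
            abs_of_nonneg (Complex.normSq_nonneg _)]
          nlinarith [hτ j, Complex.normSq_nonneg (ψ c)]
        · have := sum_spin_mul_spin_of_product hψ i j h
          rw [h1, hmean, mul_one, zero_mul] at this
          rw [← Finset.mul_sum, this, mul_zero]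
    _ = ((Finset.univ.filter fun j : Fin d => b (Sum.inl j) = b (Sum.inl i)).card : ℝ) := by
        simp
    _ ≤ m := by exact_mod_cast hm _

/-! ### Heisenberg-picture observables and their time integrals -/

/-- A diagonal observable in the Heisenberg picture. -/
def heisenberg {d n : ℕ} (V : UnitaryOp d n) (h : Config d n → ℝ) : Op d n :=
  (V : Op d n)ᴴ * Matrix.diagonal (fun c => (h c : ℂ)) * (V : Op d n)

theorem heisenberg_apply {d n : ℕ} (V : UnitaryOp d n) (h : Config d n → ℝ) (a b : Config d n) :
    heisenberg V h a b = ∑ c, star ((V : Op d n) c a) * h c * (V : Op d n) c b := by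
  rw [heisenberg, Matrix.mul_apply]
  refine Finset.sum_congr rfl fun c _ => ?_
  rw [Matrix.mul_diagonal, Matrix.conjTranspose_apply]

theorem conjTranspose_heisenberg {d n : ℕ} (V : UnitaryOp d n) (h : Config d n → ℝ) :
    (heisenberg V h)ᴴ = heisenberg V h := by
  ext a b
  simp [Matrix.conjTranspose_apply, heisenberg_apply, mul_comm, mul_left_comm]

theorem heisenberg_sum {d n : ℕ} {ι : Type*} (V : UnitaryOp d n) (S : Finset ι) (w : ι → ℝ)
    (h : ι → Config d n → ℝ) (a b : Config d n) :
    heisenberg V (fun c => ∑ i ∈ S, w i * h i c) a b =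
      ∑ i ∈ S, (w i : ℂ) * heisenberg V (h i) a b := by
  simp only [heisenberg_apply, Complex.ofReal_sum, Complex.ofReal_mul, Finset.mul_sum,
    Finset.sum_mul]
  rw [Finset.sum_comm]
  exact Finset.sum_congr rfl fun i _ => Finset.sum_congr rfl fun c _ => by ring

theorem dotProduct_heisenberg {d n : ℕ} (V : UnitaryOp d n) (h : Config d n → ℝ) (x y : Ket d n) :
    (∑ a, ∑ b, star (y a) * (heisenberg V h a b * x b)).re =
      ∑ c, h c * (star (((V : Op d n) *ᵥ y) c) * ((V : Op d n) *ᵥ x) c).re := by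
  have e : (∑ a, ∑ b, star (y a) * (heisenberg V h a b * x b)) =
      star ((V : Op d n) *ᵥ y) ⬝ᵥ
        (Matrix.diagonal (fun c => (h c : ℂ)) *ᵥ ((V : Op d n) *ᵥ x)) := by
    rw [Matrix.star_mulVec, ← Matrix.dotProduct_mulVec, Matrix.mulVec_mulVec,
      Matrix.mulVec_mulVec]
    simp only [dotProduct, Matrix.mulVec, Finset.mul_sum, Pi.star_apply, heisenberg, Matrix.mul_assoc]
  rw [e]
  simp only [dotProduct, Matrix.mulVec_diagonal, Pi.star_apply, Complex.re_sum]
  refine Finset.sum_congr rfl fun c _ => ?_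
  rw [mul_left_comm, Complex.re_ofReal_mul]

theorem sum_succ_sub_castSucc {n : ℕ} (f : Fin (n + 1) → ℝ) :
    ∑ l : Fin n, (f l.succ - f l.castSucc) = f (Fin.last n) - f 0 := by
  induction n with
  | zero => simp
  | succ n ih =>
    rw [Fin.sum_univ_castSucc]
    have := ih fun l => f l.castSucc
    simp only [Fin.succ_castSucc, Fin.castSucc_zero, Fin.succ_last] at this ⊢
    rw [this]
    ring

namespace Protocol

variable {d : ℕ} {t : ℝ}

/-- The time integral of a diagonal observable in the Heisenberg picture. -/
def integrated (P : Protocol d t) (U : Fin (P.numGates + 1) → ℝ → UnitaryOp d P.numAncilla)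
    (h : Config d P.numAncilla → ℝ) : Op d P.numAncilla :=
  Matrix.of fun a b => ∑ l, ∫ s in P.segment l, heisenberg (U l s) h a b

theorem time_le_time_succ (P : Protocol d t) (l : Fin (P.numGates + 1)) :
    P.time l.castSucc ≤ P.time l.succ :=
  P.time_mono (Fin.castSucc_le_succ l)

theorem intervalIntegral_eq_segment (P : Protocol d t) (l : Fin (P.numGates + 1)) (f : ℝ → ℂ) :
    ∫ s in (P.time l.castSucc)..(P.time l.succ), f s = ∫ s in P.segment l, f s := by
  rw [intervalIntegral.integral_of_le (P.time_le_time_succ l), segment, integral_Icc_eq_integral_Ioc]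

theorem sum_time_sub (P : Protocol d t) :
    ∑ l : Fin (P.numGates + 1), (P.time l.succ - P.time l.castSucc) = t := by
  rw [sum_succ_sub_castSucc, P.time_zero, P.time_last, sub_zero]

theorem evolvedGenerator_eq (P : Protocol d t)
    (U : Fin (P.numGates + 1) → ℝ → UnitaryOp d P.numAncilla) (j : Fin d) :
    P.evolvedGenerator U j = (-(1 / 2) : ℂ) • P.integrated U (spin j) := by
  ext a b
  have h : ∀ l s, ((U l s : Op d P.numAncilla)ᴴ * generator P.numAncilla j *
      (U l s : Op d P.numAncilla)) a b = (1 / 2 : ℂ) * heisenberg (U l s) (spin j) a b := by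
    intro l s
    rw [generator_eq_diagonal, Matrix.mul_smul, Matrix.smul_mul, Matrix.smul_apply, smul_eq_mul,
      heisenberg]
  simp only [evolvedGenerator, integrated, Matrix.of_apply, Matrix.smul_apply,
    intervalIntegral_eq_segment, h, smul_eq_mul]
  simp only [integral_const_mul, ← Finset.mul_sum]
  ring

theorem continuousOn_entry {P : Protocol d t}
    {U : Fin (P.numGates + 1) → ℝ → UnitaryOp d P.numAncilla}
    (hU : ∀ l, ContinuousOn (fun s => (U l s : Op d P.numAncilla)) (P.segment l))
    (l : Fin (P.numGates + 1)) (a b : Config d P.numAncilla) :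
    ContinuousOn (fun s => (U l s : Op d P.numAncilla) a b) (P.segment l) :=
  continuousOn_pi.1 (continuousOn_pi.1 (hU l) a) b

theorem continuousOn_mulVec {P : Protocol d t}
    {U : Fin (P.numGates + 1) → ℝ → UnitaryOp d P.numAncilla}
    (hU : ∀ l, ContinuousOn (fun s => (U l s : Op d P.numAncilla)) (P.segment l))
    (l : Fin (P.numGates + 1)) (x : Ket d P.numAncilla) (c : Config d P.numAncilla) :
    ContinuousOn (fun s => ((U l s : Op d P.numAncilla) *ᵥ x) c) (P.segment l) := by
  simp only [Matrix.mulVec, dotProduct]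
  exact continuousOn_finsetSum _ fun b _ => (continuousOn_entry hU l c b).mul continuousOn_const

theorem integrableOn_heisenberg {P : Protocol d t}
    {U : Fin (P.numGates + 1) → ℝ → UnitaryOp d P.numAncilla}
    (hU : ∀ l, ContinuousOn (fun s => (U l s : Op d P.numAncilla)) (P.segment l))
    (h : Config d P.numAncilla → ℝ) (l : Fin (P.numGates + 1)) (a b : Config d P.numAncilla) :
    IntegrableOn (fun s => heisenberg (U l s) h a b) (P.segment l) := by
  simp only [heisenberg_apply]
  exact (continuousOn_finsetSum _ fun c _ => ((continuousOn_entry hU l c a).star.mul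
    continuousOn_const).mul (continuousOn_entry hU l c b)).integrableOn_compact isCompact_Icc

theorem conjTranspose_integrated (P : Protocol d t)
    (U : Fin (P.numGates + 1) → ℝ → UnitaryOp d P.numAncilla) (h : Config d P.numAncilla → ℝ) :
    (P.integrated U h)ᴴ = P.integrated U h := by
  ext a b
  simp only [integrated, Matrix.conjTranspose_apply, Matrix.of_apply, star_sum]
  refine Finset.sum_congr rfl fun l _ => ?_
  refine (integral_conj (𝕜 := ℂ)).symm.trans (integral_congr_ae (ae_of_all _ fun s => ?_))
  exact congrFun (congrFun (conjTranspose_heisenberg (U l s) h) a) b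

theorem integrated_sum {P : Protocol d t}
    {U : Fin (P.numGates + 1) → ℝ → UnitaryOp d P.numAncilla}
    (hU : ∀ l, ContinuousOn (fun s => (U l s : Op d P.numAncilla)) (P.segment l))
    (w : Fin d → ℝ) (h : Fin d → Config d P.numAncilla → ℝ) :
    P.integrated U (fun c => ∑ i, w i * h i c) = ∑ i, (w i : ℂ) • P.integrated U (h i) := by
  ext a b
  simp only [integrated, Matrix.of_apply, Matrix.sum_apply, Matrix.smul_apply, smul_eq_mul,
    heisenberg_sum, Finset.mul_sum]
  rw [Finset.sum_comm]
  refine Finset.sum_congr rfl fun l _ => ?_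
  rw [integral_finsetSum _ fun i _ => (integrableOn_heisenberg hU _ l a b).const_mul _]
  simp only [integral_const_mul]

/-- Matrix elements of an integrated observable. -/
theorem re_dotProduct_integrated {P : Protocol d t}
    {U : Fin (P.numGates + 1) → ℝ → UnitaryOp d P.numAncilla}
    (hU : ∀ l, ContinuousOn (fun s => (U l s : Op d P.numAncilla)) (P.segment l))
    (h : Config d P.numAncilla → ℝ) (x y : Ket d P.numAncilla) :
    (star y ⬝ᵥ (P.integrated U h *ᵥ x)).re =
      ∑ l, ∫ s in P.segment l, ∑ c, h c *
        (star (((U l s : Op d P.numAncilla) *ᵥ y) c) * ((U l s : Op d P.numAncilla) *ᵥ x) c).re := by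
  have hint : ∀ l a b, IntegrableOn (fun s => star (y a) * (heisenberg (U l s) h a b * x b))
      (P.segment l) := fun l a b =>
    ((integrableOn_heisenberg hU _ l a b).mul_const _).const_mul _
  have hre : ∀ l, ∫ s in P.segment l,
      (∑ a, ∑ b, star (y a) * (heisenberg (U l s) h a b * x b)).re =
      (∑ a, ∑ b, star (y a) * ((∫ s in P.segment l, heisenberg (U l s) h a b) * x b)).re := by
    intro l
    refine (integral_re (𝕜 := ℂ) (integrable_finsetSum _ fun a _ =>
      integrable_finsetSum _ fun b _ => hint l a b)).trans ?_
    rw [integral_finsetSum _ fun a _ => integrable_finsetSum _ fun b _ => hint l a b]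
    simp only [integral_finsetSum _ fun b _ => hint l _ b, integral_const_mul, integral_mul_const]
    rfl
  simp only [← dotProduct_heisenberg, hre]
  rw [← Complex.re_sum]
  congr 1
  simp only [dotProduct, Matrix.mulVec, Pi.star_apply, integrated, Matrix.of_apply,
    Finset.sum_mul, Finset.mul_sum]
  symm
  rw [Finset.sum_comm]
  refine Finset.sum_congr rfl fun a _ => ?_
  rw [Finset.sum_comm]

end Protocol

theorem sum_normSq_mulVec {d n : ℕ} (V : UnitaryOp d n) (x : Ket d n) :
    ∑ c, Complex.normSq (((V : Op d n) *ᵥ x) c) = ∑ c, Complex.normSq (x c) := by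
  have h : star ((V : Op d n) *ᵥ x) ⬝ᵥ ((V : Op d n) *ᵥ x) = star x ⬝ᵥ x := by
    rw [Matrix.star_mulVec, ← Matrix.dotProduct_mulVec, Matrix.mulVec_mulVec,
      ← Matrix.star_eq_conjTranspose, Matrix.UnitaryGroup.star_mul_self, Matrix.one_mulVec]
  have e : ∀ y : Ket d n, (star y ⬝ᵥ y) = ((∑ c, Complex.normSq (y c) : ℝ) : ℂ) := by
    intro y
    simp [dotProduct, Complex.normSq_eq_conj_mul_self]
  rw [e, e] at h
  exact_mod_cast h

theorem re_star_mulVec_dotProduct {d n : ℕ} (V : UnitaryOp d n) (x y : Ket d n) :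
    ∑ c, (star (((V : Op d n) *ᵥ y) c) * ((V : Op d n) *ᵥ x) c).re = (star y ⬝ᵥ x).re := by
  have h : star ((V : Op d n) *ᵥ y) ⬝ᵥ ((V : Op d n) *ᵥ x) = star y ⬝ᵥ x := by
    rw [Matrix.star_mulVec, ← Matrix.dotProduct_mulVec, Matrix.mulVec_mulVec,
      ← Matrix.star_eq_conjTranspose, Matrix.UnitaryGroup.star_mul_self, Matrix.one_mulVec]
  rw [← h, dotProduct, Complex.re_sum]
  rfl

/-! ### Fisher information as a covariance, and the lower bound -/

namespace Protocol

variable {d : ℕ} {t : ℝ}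

/-- The covariance of two integrated observables in the probe state. -/
def covariance (P : Protocol d t) (U : Fin (P.numGates + 1) → ℝ → UnitaryOp d P.numAncilla)
    (g h : Config d P.numAncilla → ℝ) : ℝ :=
  (star (P.integrated U g *ᵥ P.probe) ⬝ᵥ (P.integrated U h *ᵥ P.probe)).re -
    expectation P.probe (P.integrated U g) * expectation P.probe (P.integrated U h)

theorem re_star_dotProduct_comm {d n : ℕ} (x y : Ket d n) :
    (star x ⬝ᵥ y).re = (star y ⬝ᵥ x).re := by
  simp only [dotProduct, Complex.re_sum, Pi.star_apply]
  refine Finset.sum_congr rfl fun c _ => ?_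
  simp [Complex.mul_re]
  ring

/-- The prefactor `4` cancels the two factors `-1/2` of the generators. Since integrated observables
are Hermitian, symmetrizing the product amounts to taking a real part. -/
theorem fisher_eq_covariance (P : Protocol d t)
    (U : Fin (P.numGates + 1) → ℝ → UnitaryOp d P.numAncilla) (i j : Fin d) :
    P.fisher U i j = P.covariance U (spin i) (spin j) := by
  have hprod : ∀ g h, expectation P.probe (P.integrated U g * P.integrated U h) =
      (star (P.integrated U g *ᵥ P.probe) ⬝ᵥ (P.integrated U h *ᵥ P.probe)).re := by
    intro g h
    rw [expectation, Matrix.star_mulVec, ← Matrix.dotProduct_mulVec, Matrix.mulVec_mulVec,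
      conjTranspose_integrated]
  have hadd : ∀ A B : Op d P.numAncilla, expectation P.probe (A + B) =
      expectation P.probe A + expectation P.probe B := by
    intro A B; simp [expectation, Matrix.add_mulVec]
  have hsmul : ∀ (r : ℝ) (A : Op d P.numAncilla), expectation P.probe ((r : ℂ) • A) =
      r * expectation P.probe A := by
    intro r A
    rw [expectation, Matrix.smul_mulVec, dotProduct_smul, smul_eq_mul, Complex.re_ofReal_mul,
      expectation]
  have hE : ∀ j, P.evolvedGenerator U j = ((-(1 / 2) : ℝ) : ℂ) • P.integrated U (spin j) := by
    intro j; rw [evolvedGenerator_eq]; simp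
  simp only [fisher, Matrix.of_apply, hE, Matrix.smul_mul, Matrix.mul_smul, hadd, hsmul, hprod,
    covariance]
  rw [re_star_dotProduct_comm (P.integrated U (spin j) *ᵥ P.probe)]
  ring

theorem covariance_comm (P : Protocol d t)
    (U : Fin (P.numGates + 1) → ℝ → UnitaryOp d P.numAncilla) (g h : Config d P.numAncilla → ℝ) :
    P.covariance U g h = P.covariance U h g := by
  rw [covariance, covariance, re_star_dotProduct_comm, mul_comm (expectation _ _)]

theorem covariance_sum_right {P : Protocol d t}
    {U : Fin (P.numGates + 1) → ℝ → UnitaryOp d P.numAncilla}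
    (hU : ∀ l, ContinuousOn (fun s => (U l s : Op d P.numAncilla)) (P.segment l))
    (w : Fin d → ℝ) (g : Config d P.numAncilla → ℝ) (h : Fin d → Config d P.numAncilla → ℝ) :
    P.covariance U g (fun c => ∑ i, w i * h i c) = ∑ i, w i * P.covariance U g (h i) := by
  have hsum : ∀ y : Ket d P.numAncilla,
      (star y ⬝ᵥ (P.integrated U (fun c => ∑ i, w i * h i c) *ᵥ P.probe)).re =
      ∑ i, w i * (star y ⬝ᵥ (P.integrated U (h i) *ᵥ P.probe)).re := by
    intro y
    rw [integrated_sum hU, Matrix.sum_mulVec, dotProduct_sum, Complex.re_sum]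
    refine Finset.sum_congr rfl fun i _ => ?_
    rw [Matrix.smul_mulVec, dotProduct_smul, smul_eq_mul, Complex.re_ofReal_mul]
  simp only [covariance, expectation, hsum]
  rw [Finset.mul_sum, ← Finset.sum_sub_distrib]
  exact Finset.sum_congr rfl fun i _ => by ring

theorem integrable_const_segment (P : Protocol d t) (l : Fin (P.numGates + 1)) (r : ℝ) :
    Integrable (fun _ => r) (volume.restrict (P.segment l)) :=
  integrableOn_const (by simp [segment])

/-- If an observable bounded by one has the largest possible integrated variance, then its
integrated mean vanishes, and at almost every time it acts on the state as a constant vector in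
the Heisenberg picture. -/
theorem ae_of_covariance_eq_sq {P : Protocol d t} (ht : 0 < t)
    {U : Fin (P.numGates + 1) → ℝ → UnitaryOp d P.numAncilla}
    (hU : ∀ l, ContinuousOn (fun s => (U l s : Op d P.numAncilla)) (P.segment l))
    {g : Config d P.numAncilla → ℝ} (hg : ∀ c, g c ^ 2 ≤ 1)
    (hcov : P.covariance U g g = t ^ 2) :
    expectation P.probe (P.integrated U g) = 0 ∧
    ∀ l, ∀ᵐ s ∂(volume.restrict (P.segment l)),
      (∀ c, ((U l s : Op d P.numAncilla) *ᵥ (P.integrated U g *ᵥ P.probe)) c =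
        (t * g c : ℝ) * ((U l s : Op d P.numAncilla) *ᵥ P.probe) c) ∧
      ∑ c, (1 - g c ^ 2) * Complex.normSq (((U l s : Op d P.numAncilla) *ᵥ P.probe) c) = 0 := by
  set ψ := P.probe with hψ
  set x := P.integrated U g *ᵥ ψ with hx
  set N : ℝ := ∑ c, Complex.normSq (x c) with hN
  have hself : ∀ y : Ket d P.numAncilla, (star y ⬝ᵥ y) = ((∑ c, Complex.normSq (y c) : ℝ) : ℂ) := by
    intro y
    simp [dotProduct, Complex.normSq_eq_conj_mul_self]
  have hψ1 : ∑ c, Complex.normSq (ψ c) = 1 := by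
    have := P.probe_unit
    rw [hself] at this
    exact_mod_cast this
  have hNcov : N - expectation ψ (P.integrated U g) ^ 2 = t ^ 2 := by
    rw [← hcov, covariance, hself, Complex.ofReal_re, sq]
  -- The saturation defect `‖U x - t g U ψ‖² + t² ⟨1 - g²⟩`, with `x = G ψ`: both conclusions at the
  -- time `s` say that it vanishes.
  set F : Fin (P.numGates + 1) → ℝ → ℝ := fun l s =>
    ∑ c, Complex.normSq (((U l s : Op d P.numAncilla) *ᵥ x) c -
        (t * g c : ℝ) * ((U l s : Op d P.numAncilla) *ᵥ ψ) c) +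
      t ^ 2 * ∑ c, (1 - g c ^ 2) * Complex.normSq (((U l s : Op d P.numAncilla) *ᵥ ψ) c) with hF
  have hF0 : ∀ l s, 0 ≤ F l s := fun l s => add_nonneg
    (Finset.sum_nonneg fun c _ => Complex.normSq_nonneg _)
    (mul_nonneg (sq_nonneg _) (Finset.sum_nonneg fun c _ =>
      mul_nonneg (by linarith [hg c]) (Complex.normSq_nonneg _)))
  set R : Fin (P.numGates + 1) → ℝ → ℝ := fun l s => ∑ c, g c *
    (star (((U l s : Op d P.numAncilla) *ᵥ x) c) * ((U l s : Op d P.numAncilla) *ᵥ ψ) c).re with hR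
  -- Expanding the square, the terms `t² ⟨g²⟩` cancel and unitarity makes the norms constant; only
  -- the cross term `R` depends on time, and it integrates to `N = ‖x‖²`.
  have hFR : ∀ l s, F l s = (N + t ^ 2) - 2 * t * R l s := by
    intro l s
    have h1 := sum_normSq_mulVec (U l s) x
    have h2 := sum_normSq_mulVec (U l s) ψ
    rw [hψ1] at h2
    rw [hN, ← h1]
    conv_rhs => rw [← mul_one (t ^ 2), ← h2]
    simp only [hF, hR, Finset.mul_sum, ← Finset.sum_add_distrib, ← Finset.sum_sub_distrib]
    refine Finset.sum_congr rfl fun c _ => ?_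
    simp only [Complex.normSq_apply, Complex.sub_re, Complex.sub_im, Complex.ofReal_re,
      Complex.ofReal_im, Complex.mul_im, Complex.mul_re, Complex.star_def, Complex.conj_re, Complex.conj_im]
    ring
  have hRint : ∀ l, IntegrableOn (R l) (P.segment l) := by
    intro l
    refine ContinuousOn.integrableOn_compact isCompact_Icc ?_
    refine continuousOn_finsetSum _ fun c _ => continuousOn_const.mul ?_
    exact Complex.continuous_re.comp_continuousOn
      ((continuousOn_mulVec hU l x c).star.mul (continuousOn_mulVec hU l ψ c))
  have hRsum : ∑ l, ∫ s in P.segment l, R l s = N := by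
    rw [← re_dotProduct_integrated hU g ψ x, ← hx, hself, Complex.ofReal_re]
  have hvol : ∀ l, volume.real (P.segment l) = P.time l.succ - P.time l.castSucc := fun l =>
    Real.volume_real_Icc_of_le (P.time_le_time_succ l)
  have hFint : ∀ l, IntegrableOn (F l) (P.segment l) := by
    intro l
    rw [show F l = fun s => (N + t ^ 2) - 2 * t * R l s from funext (hFR l)]
    exact (integrable_const_segment P l _).sub ((hRint l).const_mul _)
  have hFsum : ∑ l, ∫ s in P.segment l, F l s = t * (t ^ 2 - N) := by
    have : ∀ l, ∫ s in P.segment l, F l s =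
        (P.time l.succ - P.time l.castSucc) * (N + t ^ 2) -
          2 * t * ∫ s in P.segment l, R l s := by
      intro l
      simp only [hFR]
      rw [integral_sub (integrable_const_segment P l _) ((hRint l).const_mul _),
        integral_const_mul, setIntegral_const, hvol, smul_eq_mul]
    simp only [this]
    rw [Finset.sum_sub_distrib, ← Finset.sum_mul, ← Finset.mul_sum, hRsum, P.sum_time_sub]
    ring
  have hnn : ∀ l, 0 ≤ ∫ s in P.segment l, F l s := fun l => integral_nonneg (hF0 l)
  -- The defect integrates to `t (t² - N) ≥ 0`, whereas `N = t² + ⟨G⟩²` by hypothesis. So `N = t²`,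
  -- the mean is zero and the defect vanishes almost everywhere.
  have hNle : N ≤ t ^ 2 := by
    have := hFsum ▸ Finset.sum_nonneg fun l (_ : l ∈ Finset.univ) => hnn l
    linarith [nonneg_of_mul_nonneg_right this ht]
  have hE : expectation ψ (P.integrated U g) = 0 := by
    have : expectation ψ (P.integrated U g) ^ 2 = 0 :=
      le_antisymm (by linarith) (sq_nonneg _)
    exact pow_eq_zero_iff two_ne_zero |>.1 this
  have hNeq : N = t ^ 2 := by rw [← hNcov, hE]; ring
  refine ⟨hE, fun l => ?_⟩
  have hzero : ∫ s in P.segment l, F l s = 0 := by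
    refine (Finset.sum_eq_zero_iff_of_nonneg fun l _ => hnn l).1 ?_ l (Finset.mem_univ l)
    rw [hFsum, hNeq]; ring
  filter_upwards [(integral_eq_zero_iff_of_nonneg (hF0 l) (hFint l)).1 hzero] with s hs
  have h1 : 0 ≤ ∑ c, Complex.normSq (((U l s : Op d P.numAncilla) *ᵥ x) c -
        (t * g c : ℝ) * ((U l s : Op d P.numAncilla) *ᵥ ψ) c) :=
    Finset.sum_nonneg fun c _ => Complex.normSq_nonneg _
  have h2 : 0 ≤ ∑ c, (1 - g c ^ 2) * Complex.normSq (((U l s : Op d P.numAncilla) *ᵥ ψ) c) :=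
    Finset.sum_nonneg fun c _ => mul_nonneg (by linarith [hg c]) (Complex.normSq_nonneg _)
  have hs' : _ + t ^ 2 * _ = (0 : ℝ) := hs
  have ht2 : 0 < t ^ 2 := by positivity
  constructor
  · intro c
    have h3 := (Finset.sum_eq_zero_iff_of_nonneg fun c _ => Complex.normSq_nonneg _).1
      (le_antisymm (by nlinarith) h1) c (Finset.mem_univ c)
    exact sub_eq_zero.1 (Complex.normSq_eq_zero.1 h3)
  · exact le_antisymm (by nlinarith) h2

/-- If an optimal protocol uses at most `m`-partite entanglement, then `‖α‖₁ / ‖α‖∞ ≤ m`. -/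
theorem sum_abs_le_of_isOptimal {P : Protocol d t} (ht : 0 < t) {α : Fin d → ℝ} (hα : 0 < ‖α‖)
    {U : Fin (P.numGates + 1) → ℝ → UnitaryOp d P.numAncilla}
    (hU : ∀ l, ContinuousOn (fun s => (U l s : Op d P.numAncilla)) (P.segment l))
    (hopt : P.IsOptimal α U) {m : ℕ} (hm : P.EntanglementAtMostAE m U) :
    (∑ j, |α j|) / ‖α‖ ≤ m := by
  obtain ⟨lam, hlam0, hlamz, hlam1, hlam⟩ := hopt
  have hsgn : ∀ a : ℝ, Real.sign a * a = |a| := by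
    intro a
    rcases lt_trichotomy a 0 with h | h | h
    · rw [Real.sign_of_neg h, abs_of_neg h]; ring
    · simp [h]
    · rw [Real.sign_of_pos h, abs_of_pos h]; ring
  have hsabs : ∀ a : ℝ, |Real.sign a| ≤ 1 := by
    intro a
    rcases Real.sign_apply_eq a with h | h | h <;> simp [h]
  set w : Fin d → ℝ := fun i => lam i * Real.sign (α i) with hw
  set g : Config d P.numAncilla → ℝ := fun c => ∑ i, w i * spin i c with hgdef
  set z : Config d P.numAncilla → ℝ := fun c => ∑ i, Real.sign (α i) * spin i c with hzdef
  have hw1 : ∑ i, |w i| = 1 := by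
    rw [← hlam1]
    refine Finset.sum_congr rfl fun i _ => ?_
    rw [hw]
    simp only [abs_mul, abs_of_nonneg (hlam0 i)]
    by_cases h : |α i| = ‖α‖
    · have h0 : α i ≠ 0 := by
        rw [← abs_pos, h]; exact hα
      rcases lt_or_gt_of_ne h0 with h | h
      · simp [Real.sign_of_neg h]
      · simp [Real.sign_of_pos h]
    · simp [hlamz i h]
  have hcovj : ∀ j, P.covariance U (spin j) g = t ^ 2 / ‖α‖ * α j := by
    intro j
    rw [hgdef, covariance_sum_right hU, ← hlam j]
    exact Finset.sum_congr rfl fun i _ => by rw [fisher_eq_covariance]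
  have hcomb : ∀ v : Fin d → ℝ, P.covariance U g (fun c => ∑ i, v i * spin i c) =
      t ^ 2 / ‖α‖ * ∑ i, v i * α i := by
    intro v
    rw [covariance_sum_right hU, Finset.mul_sum]
    exact Finset.sum_congr rfl fun i _ => by rw [covariance_comm, hcovj]; ring
  -- Because `lam` lives on the indices with `|α i| = ‖α‖`, the pairing `∑ w i * α i` is exactly
  -- `‖α‖`.
  have hgg : P.covariance U g g = t ^ 2 := by
    rw [hgdef, hcomb]
    have : ∑ i, w i * α i = ‖α‖ := by
      rw [← one_mul ‖α‖, ← hlam1, Finset.sum_mul]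
      refine Finset.sum_congr rfl fun i _ => ?_
      rw [hw]
      simp only [mul_assoc, hsgn]
      by_cases h : |α i| = ‖α‖
      · rw [h]
      · simp [hlamz i h]
    rw [this]; field_simp
  have hgz : P.covariance U g z = t ^ 2 * ((∑ j, |α j|) / ‖α‖) := by
    rw [hzdef, hcomb]
    simp only [hsgn]
    ring
  have hgle : ∀ c, g c ^ 2 ≤ 1 := by
    intro c
    rw [sq_le_one_iff_abs_le_one, ← hw1]
    refine (Finset.abs_sum_le_sum_abs _ _).trans (Finset.sum_le_sum fun j _ => ?_)
    rw [abs_mul, abs_spin, mul_one]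
  obtain ⟨hE, hae⟩ := ae_of_covariance_eq_sq ht hU hgle hgg
  have hψ1 : ∑ c, Complex.normSq (P.probe c) = 1 := by
    have := P.probe_unit
    have e : (star P.probe ⬝ᵥ P.probe) = ((∑ c, Complex.normSq (P.probe c) : ℝ) : ℂ) := by
      simp [dotProduct, Complex.normSq_eq_conj_mul_self]
    rw [e] at this
    exact_mod_cast this
  have hbound : ∀ l, ∫ s in P.segment l, ∑ c, z c *
      (star (((U l s : Op d P.numAncilla) *ᵥ (P.integrated U g *ᵥ P.probe)) c) *
        ((U l s : Op d P.numAncilla) *ᵥ P.probe) c).re ≤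
      (P.time l.succ - P.time l.castSucc) * (t * m) := by
    intro l
    rw [← Real.volume_real_Icc_of_le (P.time_le_time_succ l), ← smul_eq_mul,
      ← setIntegral_const]
    refine integral_mono_ae ?_ (integrable_const_segment P l _) ?_
    · refine ContinuousOn.integrableOn_compact isCompact_Icc ?_
      refine continuousOn_finsetSum _ fun c _ => continuousOn_const.mul ?_
      exact Complex.continuous_re.comp_continuousOn
        ((continuousOn_mulVec hU l _ c).star.mul (continuousOn_mulVec hU l _ c))
    · filter_upwards [hae l, hm l] with s hs hp
      obtain ⟨hs1, hs2⟩ := hs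
      have hre : ∀ c, (star (((U l s : Op d P.numAncilla) *ᵥ (P.integrated U g *ᵥ P.probe)) c) *
          ((U l s : Op d P.numAncilla) *ᵥ P.probe) c).re =
          t * (g c * Complex.normSq (((U l s : Op d P.numAncilla) *ᵥ P.probe) c)) := by
        intro c
        rw [hs1 c]
        simp only [Complex.normSq_apply, Complex.ofReal_re, Complex.ofReal_im,
          Complex.mul_re, Complex.mul_im, Complex.star_def, Complex.conj_re, Complex.conj_im]
        ring
      -- At a good time, `t ⟨g⟩` in `ψ(s)` equals `⟨ψ(0), G ψ(0)⟩`, which is zero.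
      have h0 : ∑ c, g c * Complex.normSq (((U l s : Op d P.numAncilla) *ᵥ P.probe) c) = 0 := by
        have := re_star_mulVec_dotProduct (U l s) P.probe (P.integrated U g *ᵥ P.probe)
        simp only [hre] at this
        rw [re_star_dotProduct_comm] at this
        rw [← Finset.mul_sum, show (star P.probe ⬝ᵥ (P.integrated U g *ᵥ P.probe)).re = 0 from hE]
          at this
        exact (mul_eq_zero.1 this).resolve_left ht.ne'
      have hfin := sum_correlation_le_of_producible hp hw1 (fun i => hsabs (α i))
        (by rw [sum_normSq_mulVec, hψ1]) hs2 h0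
      simp only [hre]
      calc ∑ c, z c * (t * (g c * Complex.normSq (((U l s : Op d P.numAncilla) *ᵥ P.probe) c)))
          = t * ∑ c, g c * z c * Complex.normSq (((U l s : Op d P.numAncilla) *ᵥ P.probe) c) := by
            rw [Finset.mul_sum]
            exact Finset.sum_congr rfl fun c _ => by ring
        _ ≤ t * m := mul_le_mul_of_nonneg_left hfin ht.le
  have hfinal : t ^ 2 * ((∑ j, |α j|) / ‖α‖) ≤ t ^ 2 * m := by
    rw [← hgz, covariance, hE, zero_mul, sub_zero, re_dotProduct_integrated hU]
    refine (Finset.sum_le_sum fun l _ => hbound l).trans ?_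
    rw [← Finset.sum_mul, P.sum_time_sub]
    exact le_of_eq (by ring)
  exact le_of_mul_le_mul_left hfinal (by positivity)

end Protocol

/-! ### The polytope of activities and the time schedule -/

/-- The points of the unit cube whose coordinates add up to at most `k`. -/
def cappedCube (d k : ℕ) : Set (Fin d → ℝ) :=
  {a | (∀ j, 0 ≤ a j) ∧ (∀ j, a j ≤ 1) ∧ ∑ j, a j ≤ k}

/-- The vertices of `cappedCube d k`. -/
def cappedCubeVertices (d k : ℕ) : Set (Fin d → ℝ) :=
  {a | ∃ B : Finset (Fin d), B.card ≤ k ∧ a = fun j => if j ∈ B then 1 else 0}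

theorem convex_cappedCube (d k : ℕ) : Convex ℝ (cappedCube d k) := by
  rintro x ⟨hx0, hx1, hxs⟩ y ⟨hy0, hy1, hys⟩ a b ha hb hab
  refine ⟨fun j => ?_, fun j => ?_, ?_⟩
  · have := mul_nonneg ha (hx0 j)
    have := mul_nonneg hb (hy0 j)
    simp only [Pi.add_apply, Pi.smul_apply, smul_eq_mul]
    linarith
  · have := mul_le_mul_of_nonneg_left (hx1 j) ha
    have := mul_le_mul_of_nonneg_left (hy1 j) hb
    simp only [Pi.add_apply, Pi.smul_apply, smul_eq_mul]
    linarith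
  · have := mul_le_mul_of_nonneg_left hxs ha
    have := mul_le_mul_of_nonneg_left hys hb
    simp only [Pi.add_apply, Pi.smul_apply, smul_eq_mul, Finset.sum_add_distrib, ← Finset.mul_sum]
    have e : (k : ℝ) = a * k + b * k := by rw [← add_mul, hab, one_mul]
    linarith

theorem isCompact_cappedCube (d k : ℕ) : IsCompact (cappedCube d k) := by
  have e : cappedCube d k = Set.Icc 0 1 ∩ {a | ∑ j, a j ≤ (k : ℝ)} := by
    ext a
    simp only [cappedCube, Set.mem_ofPred_eq, Set.mem_inter_iff, Set.mem_Icc, Pi.le_def,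
      Pi.zero_apply, Pi.one_apply, and_assoc]
  rw [e]
  exact isCompact_Icc.inter_right (isClosed_le (by fun_prop) continuous_const)

theorem eq_zero_of_add_sub_mem {E : Type*} [AddCommGroup E] [Module ℝ E] {s : Set E} {x v : E}
    (hx : x ∈ Set.extremePoints ℝ s) (h1 : x + v ∈ s) (h2 : x - v ∈ s) : v = 0 := by
  have h := (mem_extremePoints.1 hx).2 (x + v) h1 (x - v) h2
    ⟨1 / 2, 1 / 2, by norm_num, by norm_num, by norm_num, by
      rw [← smul_add, add_add_sub_cancel, ← two_smul ℝ x, smul_smul]; norm_num⟩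
  simpa using h.1

theorem extremePoints_cappedCube_subset (d k : ℕ) :
    Set.extremePoints ℝ (cappedCube d k) ⊆ cappedCubeVertices d k := by
  intro a ha
  obtain ⟨h0, h1, hs⟩ := ha.1
  have hint : ∀ j, a j = 0 ∨ a j = 1 := by
    by_contra! hne
    obtain ⟨i, hi0, hi1⟩ := hne
    have hi0 : 0 < a i := lt_of_le_of_ne (h0 i) hi0.symm
    have hi1 : a i < 1 := lt_of_le_of_ne (h1 i) hi1
    -- Below the cap, a fractional coordinate can be moved alone in both directions. On the cap the
    -- sum is an integer, so there is a second fractional coordinate, and mass can be shifted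
    -- between the two.
    rcases hs.lt_or_eq with hlt | heq
    · obtain ⟨ε, hε, hε'⟩ := exists_between (lt_min hi0 (lt_min (sub_pos.2 hi1) (sub_pos.2 hlt)))
      obtain ⟨e1, e2, e3⟩ : ε < a i ∧ ε < 1 - a i ∧ ε < k - ∑ j, a j := by simpa using hε'
      have hv : (Pi.single i ε : Fin d → ℝ) = 0 := by
        refine eq_zero_of_add_sub_mem ha ⟨fun j => ?_, fun j => ?_, ?_⟩
          ⟨fun j => ?_, fun j => ?_, ?_⟩
        · by_cases hj : j = i
          · subst hj; simp; linarith
          · simp [hj, h0]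
        · by_cases hj : j = i
          · subst hj; simp; linarith
          · simp [hj, h1]
        · simp [Finset.sum_add_distrib]; linarith
        · by_cases hj : j = i
          · subst hj; simp; linarith
          · simp [hj, h0]
        · by_cases hj : j = i
          · subst hj; simp; linarith
          · simp [hj, h1]
        · simp [Finset.sum_sub_distrib]; linarith
      have := congrFun hv i
      simp at this
      linarith
    · obtain ⟨j, hji, hj0, hj1⟩ : ∃ j, j ≠ i ∧ a j ≠ 0 ∧ a j ≠ 1 := by
        by_contra! hall
        -- If all coordinates but `a i` were integers, `a i` would be an integer strictly between
        -- `0` and `1`. The value `0` assigned at `i` itself is a dummy.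
        have hz : ∀ j, ∃ z : ℤ, j ≠ i → a j = z := by
          intro j
          by_cases hj : j = i
          · exact ⟨0, fun h => absurd hj h⟩
          · by_cases hj0 : a j = 0
            · exact ⟨0, fun _ => by simp [hj0]⟩
            · exact ⟨1, fun h => by simp [hall j h hj0]⟩
        choose z hz using hz
        have hsum := Finset.add_sum_erase Finset.univ a (Finset.mem_univ i)
        rw [heq, Finset.sum_congr rfl fun j hj => hz j (Finset.ne_of_mem_erase hj)] at hsum
        have e : a i = (((k : ℤ) - ∑ j ∈ Finset.univ.erase i, z j : ℤ) : ℝ) := by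
          push_cast; linarith
        rw [e] at hi0 hi1
        have := Int.cast_pos.1 hi0
        have : ((k : ℤ) - ∑ j ∈ Finset.univ.erase i, z j) < 1 := by exact_mod_cast hi1
        omega
      have hj0 : 0 < a j := lt_of_le_of_ne (h0 j) hj0.symm
      have hj1 : a j < 1 := lt_of_le_of_ne (h1 j) hj1
      obtain ⟨ε, hε, hε'⟩ := exists_between (lt_min (lt_min hi0 (sub_pos.2 hi1))
        (lt_min hj0 (sub_pos.2 hj1)))
      obtain ⟨⟨e1, e2⟩, e3, e4⟩ : (ε < a i ∧ ε < 1 - a i) ∧ ε < a j ∧ ε < 1 - a j := by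
        simpa using hε'
      have hv : (Pi.single i ε - Pi.single j ε : Fin d → ℝ) = 0 := by
        refine eq_zero_of_add_sub_mem ha ⟨fun l => ?_, fun l => ?_, ?_⟩
          ⟨fun l => ?_, fun l => ?_, ?_⟩
        · by_cases hl : l = i
          · subst hl; simp [hji.symm]; linarith
          · by_cases hl' : l = j
            · subst hl'; simp [hji]; linarith
            · simp [hl, hl', h0]
        · by_cases hl : l = i
          · subst hl; simp [hji.symm]; linarith
          · by_cases hl' : l = j
            · subst hl'; simp [hji]; linarith
            · simp [hl, hl', h1]
        · simp [Finset.sum_add_distrib, hs]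
        · by_cases hl : l = i
          · subst hl; simp [hji.symm]; linarith
          · by_cases hl' : l = j
            · subst hl'; simp [hji]; linarith
            · simp [hl, hl', h0]
        · by_cases hl : l = i
          · subst hl; simp [hji.symm]; linarith
          · by_cases hl' : l = j
            · subst hl'; simp [hji]; linarith
            · simp [hl, hl', h1]
        · simp [Finset.sum_sub_distrib, hs]
      have := congrFun hv i
      simp [hji.symm] at this
      linarith
  have hB : a = fun j => if j ∈ Finset.univ.filter fun j => a j = 1 then (1 : ℝ) else 0 := by
    ext j
    rcases hint j with h | h <;> simp [h]
  refine ⟨Finset.univ.filter fun j => a j = 1, ?_, hB⟩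
  rw [hB] at hs
  simp only [Finset.sum_ite_mem, Finset.univ_inter, Finset.sum_const, nsmul_eq_mul, mul_one] at hs
  exact_mod_cast hs

/-- Krein–Milman; the closure is harmless because the hull of finitely many points is already
closed. -/
theorem cappedCube_subset_convexHull (d k : ℕ) :
    cappedCube d k ⊆ convexHull ℝ (cappedCubeVertices d k) := by
  have hfin : (cappedCubeVertices d k).Finite := by
    refine (Set.finite_range fun B : Finset (Fin d) => fun j => if j ∈ B then (1 : ℝ) else 0).subset ?_
    rintro _ ⟨B, -, rfl⟩
    exact ⟨B, rfl⟩
  rw [← closure_convexHull_extremePoints (isCompact_cappedCube d k) (convex_cappedCube d k)]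
  exact closure_minimal (convexHull_mono (extremePoints_cappedCube_subset d k))
    (hfin.isCompact_convexHull ℝ).isClosed

/-- Fractions of time during which the members of sets of at most `k` elements, all containing
`i₀`, are active, with prescribed total activities. -/
theorem exists_schedule {d k : ℕ} (hk : 0 < k) {a : Fin d → ℝ} (h0 : ∀ j, 0 ≤ a j)
    (h1 : ∀ j, a j ≤ 1) (hs : ∑ j, a j ≤ k) {i₀ : Fin d} (hi : a i₀ = 1) :
    ∃ (n : ℕ) (B : Fin (n + 1) → Finset (Fin d)) (μ : Fin (n + 1) → ℝ),
      B 0 = {i₀} ∧ (∀ l, i₀ ∈ B l) ∧ (∀ l, (B l).card ≤ k) ∧ (∀ l, 0 ≤ μ l) ∧ ∑ l, μ l = 1 ∧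
      ∀ j, ∑ l, (if j ∈ B l then μ l else 0) = a j := by
  obtain ⟨ι, _, w, z, hw0, hw1, hz, hwz⟩ :=
    mem_convexHull_iff_exists_fintype.1 (cappedCube_subset_convexHull d k ⟨h0, h1, hs⟩)
  choose C hC hzC using hz
  have hsum : ∀ j, ∑ i, (if j ∈ C i then w i else 0) = a j := by
    intro j
    rw [← hwz]
    simp [hzC]
  -- The weights sum to `1` and those of the sets containing `i₀` already sum to `a i₀ = 1`. The
  -- sets without `i₀` thus carry no weight and may be replaced by `{i₀}`.
  have hzero : ∀ i, i₀ ∉ C i → w i = 0 := by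
    intro i hni
    have h : ∑ i, (w i - if i₀ ∈ C i then w i else 0) = 0 := by
      rw [Finset.sum_sub_distrib, hsum, hi, hw1, sub_self]
    have := (Finset.sum_eq_zero_iff_of_nonneg fun i _ => by
      split_ifs <;> simp [hw0 i]).1 h i (Finset.mem_univ i)
    simpa [hni] using this
  let e := Fintype.equivFin ι
  let D : ι → Finset (Fin d) := fun i => if i₀ ∈ C i then C i else {i₀}
  have hD : ∀ i j, (if j ∈ D i then w i else 0) = if j ∈ C i then w i else 0 := by
    intro i j
    by_cases h : i₀ ∈ C i
    · simp [D, h]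
    · simp [hzero i h]
  -- A segment of length zero with the set `{i₀}` is put in front, so that the protocol can start
  -- from the identity permutation.
  refine ⟨Fintype.card ι, Fin.cons {i₀} (D ∘ e.symm), Fin.cons 0 (w ∘ e.symm), rfl, ?_, ?_, ?_, ?_, ?_⟩
  · refine Fin.cases (by simp) fun l => ?_
    simp only [Fin.cons_succ, Function.comp, D]
    split_ifs with h
    · exact h
    · simp
  · refine Fin.cases (by simpa using Nat.succ_le_of_lt hk) fun l => ?_
    simp only [Fin.cons_succ, Function.comp, D]
    split_ifs with h
    · exact hC _
    · simpa using Nat.succ_le_of_lt hk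
  · exact Fin.cases (by simp) fun l => by simp [hw0]
  · rw [Fin.sum_univ_succ]
    simp only [Fin.cons_zero, Fin.cons_succ, Function.comp, zero_add]
    rw [e.symm.sum_comp w, hw1]
  · intro j
    rw [Fin.sum_univ_succ]
    simp only [Fin.cons_zero, Fin.cons_succ, Function.comp, hD, ite_self, zero_add]
    rw [e.symm.sum_comp fun i => if j ∈ C i then w i else 0, hsum]

/-! ### Evolution by basis permutations with phases -/

theorem phasedPerm_mem {d n : ℕ} (f : Config d n → ℝ) (V : Equiv.Perm (Config d n)) :
    (Matrix.of fun a b => if a = V b then Complex.exp (-Complex.I * f b) else 0) ∈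
      Matrix.unitaryGroup (Config d n) ℂ := by
  rw [Matrix.mem_unitaryGroup_iff']
  ext a b
  simp only [Matrix.mul_apply, Matrix.star_apply, Matrix.of_apply, Matrix.one_apply]
  simp only [mul_ite, mul_zero, Finset.sum_ite_eq', Finset.mem_univ, if_true]
  by_cases h : a = b
  · subst h
    simp [← Complex.exp_conj, ← Complex.exp_add]
  · have : V b ≠ V a := fun e => h (V.injective e).symm
    simp [h, this]

/-- The permutation `V` of the computational basis, with phases `exp (-i f)`. -/
def phasedPerm {d n : ℕ} (f : Config d n → ℝ) (V : Equiv.Perm (Config d n)) : UnitaryOp d n :=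
  ⟨Matrix.of fun a b => if a = V b then Complex.exp (-Complex.I * f b) else 0, phasedPerm_mem f V⟩

theorem phasedPerm_apply {d n : ℕ} (f : Config d n → ℝ) (V : Equiv.Perm (Config d n))
    (a b : Config d n) : (phasedPerm f V : Op d n) a b =
      if a = V b then Complex.exp (-Complex.I * f b) else 0 := rfl

theorem phasedPerm_zero_one {d n : ℕ} : phasedPerm (0 : Config d n → ℝ) 1 = 1 := by
  apply Subtype.ext
  ext a b
  rw [phasedPerm_apply]
  simp [Matrix.one_apply]

theorem phasedPerm_mul {d n : ℕ} (f g : Config d n → ℝ) (V W : Equiv.Perm (Config d n)) :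
    phasedPerm f V * phasedPerm g W = phasedPerm (fun b => f (W b) + g b) (V * W) := by
  apply Subtype.ext
  ext a b
  rw [Matrix.UnitaryGroup.mul_val, Matrix.mul_apply]
  simp only [phasedPerm_apply, mul_ite, mul_zero, Finset.sum_ite_eq', Finset.mem_univ, if_true,
    Equiv.Perm.mul_apply, ite_mul, zero_mul, ← Complex.exp_add]
  push_cast
  rw [mul_add]

/-- The phases cancel between `V` and its adjoint. They alone carry `θ`, which is why the Fisher
matrix of the protocol does not depend on the parameters. -/
theorem heisenberg_phasedPerm {d n : ℕ} (f : Config d n → ℝ) (V : Equiv.Perm (Config d n))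
    (h : Config d n → ℝ) (a b : Config d n) :
    heisenberg (phasedPerm f V) h a b = if a = b then (h (V a) : ℂ) else 0 := by
  rw [heisenberg_apply]
  simp only [phasedPerm_apply, mul_ite, mul_zero, Finset.sum_ite_eq', Finset.mem_univ, if_true]
  by_cases hab : a = b
  · subst hab
    simp only [if_true, Complex.star_def, ← Complex.exp_conj]
    rw [mul_right_comm, ← Complex.exp_add]
    simp
  · have : V b ≠ V a := fun e => hab (V.injective e).symm
    simp [hab, this]

/-- The protocol without control Hamiltonian and ancillas whose gates permute the computational
basis, such that `V l` is the total permutation before the `l`-th time segment. -/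
abbrev permProtocol {d N : ℕ} {t : ℝ} (ψ : Ket d 0) (hψ : star ψ ⬝ᵥ ψ = 1) (T : Fin (N + 2) → ℝ)
    (hT : Monotone T) (hT0 : T 0 = 0) (hTt : T (Fin.last (N + 1)) = t)
    (V : Fin (N + 1) → Equiv.Perm (Config d 0)) : Protocol d t where
  numAncilla := 0
  probe := ψ
  probe_unit := hψ
  numGates := N
  time := T
  time_mono := hT
  time_zero := hT0
  time_last := hTt
  gate l := phasedPerm 0 (V l.succ * (V l.castSucc)⁻¹)
  control _ := 0
  control_hermitian _ := Matrix.isHermitian_zero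
  control_integrable _ _ := by simp

/-- The eigenvalue of `∑ θ_j σᶻ_j / 2` on a computational basis state. -/
def energy {d n : ℕ} (θ : Fin d → ℝ) (c : Config d n) : ℝ := ∑ j, θ j * (1 / 2 * spin j c)

/-- The phase acquired by a basis state until the time `s` in the `l`-th segment. -/
def phase {d N : ℕ} (T : Fin (N + 2) → ℝ) (V : Fin (N + 1) → Equiv.Perm (Config d 0))
    (θ : Fin d → ℝ) (l : Fin (N + 1)) (s : ℝ) (c : Config d 0) : ℝ :=
  ∑ l', (if l' < l then (T l'.succ - T l'.castSucc) * energy θ (V l' c) else 0) +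
    (s - T l.castSucc) * energy θ (V l c)

/-- Gates add no phase: at a gate time the running term of the segment just finished becomes a term
of the sum over completed segments. -/
theorem phase_succ {d N : ℕ} (T : Fin (N + 2) → ℝ) (V : Fin (N + 1) → Equiv.Perm (Config d 0))
    (θ : Fin d → ℝ) (l : Fin N) (c : Config d 0) :
    phase T V θ l.succ (T l.castSucc.succ) c = phase T V θ l.castSucc (T l.castSucc.succ) c := by
  have h : ∀ l' : Fin (N + 1), (if l' < l.succ then
      (T l'.succ - T l'.castSucc) * energy θ (V l' c) else 0) =
      (if l' < l.castSucc then (T l'.succ - T l'.castSucc) * energy θ (V l' c) else 0) +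
      if l' = l.castSucc then (T l'.succ - T l'.castSucc) * energy θ (V l' c) else 0 := by
    intro l'
    simp only [Fin.lt_def, Fin.ext_iff, Fin.val_succ, Fin.val_castSucc]
    split_ifs <;> first | omega | simp
  simp only [phase, h, Finset.sum_add_distrib, Finset.sum_ite_eq', Finset.mem_univ, if_true]
  rw [← Fin.succ_castSucc, sub_self]
  ring

/-- Without control the Hamiltonian is diagonal, so the equation decouples into scalar equations,
and the phase of each basis state grows at the rate `energy θ (V l c)`. -/
theorem isEvolution_permProtocol {d N : ℕ} {t : ℝ} {ψ : Ket d 0} {hψ : star ψ ⬝ᵥ ψ = 1}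
    {T : Fin (N + 2) → ℝ} {hT : Monotone T} {hT0 : T 0 = 0} {hTt : T (Fin.last (N + 1)) = t}
    {V : Fin (N + 1) → Equiv.Perm (Config d 0)} (hV : V 0 = 1) (θ : Fin d → ℝ) :
    (permProtocol ψ hψ T hT hT0 hTt V).IsEvolution θ
      fun l s => phasedPerm (phase T V θ l s) (V l) where
  continuousOn l := by
    refine Continuous.continuousOn (continuous_pi fun a => continuous_pi fun b => ?_)
    simp only [phasedPerm_apply, phase]
    split_ifs
    · fun_prop
    · exact continuous_const
  start := by
    have : phase T V θ 0 0 = 0 := by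
      ext c; simp [phase, hT0]
    rw [this, hV, phasedPerm_zero_one]
  jump l := by
    rw [phasedPerm_mul]
    congr 1
    · ext c
      simp [phase_succ]
    · simp
  schrodinger l s _ a b := by
    have hH : ∀ r, ((permProtocol ψ hψ T hT hT0 hTt V).hamiltonian θ r *
        (phasedPerm (phase T V θ l r) (V l) : Op d 0)) a b =
        (energy θ a : ℂ) * (phasedPerm (phase T V θ l r) (V l) : Op d 0) a b := by
      intro r
      have : (permProtocol ψ hψ T hT hT0 hTt V).hamiltonian θ r =
          (Matrix.diagonal fun c => (energy θ c : ℂ) : Op d 0) := by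
        ext c c'
        simp only [Protocol.hamiltonian, generator_eq_diagonal, add_zero, Matrix.sum_apply,
          Matrix.smul_apply, smul_eq_mul, energy]
        by_cases hc : c = c'
        · subst hc; simp
        · simp [hc]
      rw [this, Matrix.diagonal_mul]
    simp only [hH]
    simp only [phasedPerm_apply]
    split_ifs with hab
    · subst hab
      have hd : ∀ r, HasDerivAt (fun r : ℝ => Complex.exp (-Complex.I * (phase T V θ l r b : ℝ)))
          (-Complex.I * ((energy θ (V l b) : ℂ) *
            Complex.exp (-Complex.I * (phase T V θ l r b : ℝ)))) r := by
        intro r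
        have h1 : HasDerivAt (fun r : ℝ => phase T V θ l r b) (energy θ (V l b)) r := by
          unfold phase
          refine HasDerivAt.const_add _ ?_
          simpa using ((hasDerivAt_id r).sub_const (T l.castSucc)).mul_const (energy θ (V l b))
        have h2 := ((h1.ofReal_comp).const_mul (-Complex.I)).cexp
        convert h2 using 1
        ring
      have hc : Continuous fun r : ℝ => (-Complex.I * ((energy θ (V l b) : ℂ) *
            Complex.exp (-Complex.I * (phase T V θ l r b : ℝ)))) := by
        unfold phase; fun_prop
      have := intervalIntegral.integral_eq_sub_of_hasDerivAt (a := T l.castSucc) (b := s)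
        (fun r _ => hd r) (hc.intervalIntegrable _ _)
      rw [intervalIntegral.integral_const_mul] at this
      linear_combination -this
    · simp

theorem integrated_phasedPerm {d N : ℕ} {t : ℝ} {ψ : Ket d 0} {hψ : star ψ ⬝ᵥ ψ = 1}
    {T : Fin (N + 2) → ℝ} {hT : Monotone T} {hT0 : T 0 = 0} {hTt : T (Fin.last (N + 1)) = t}
    {V : Fin (N + 1) → Equiv.Perm (Config d 0)} (f : Fin (N + 1) → ℝ → Config d 0 → ℝ)
    (h : Config d 0 → ℝ) :
    (permProtocol ψ hψ T hT hT0 hTt V).integrated (fun l s => phasedPerm (f l s) (V l)) h =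
      (Matrix.diagonal fun c => ((∑ l, (T l.succ - T l.castSucc) * h (V l c) : ℝ) : ℂ) : Op d 0) := by
  ext a b
  simp only [Protocol.integrated, Matrix.of_apply, heisenberg_phasedPerm, setIntegral_const,
    Protocol.segment]
  by_cases hab : a = b
  · subst hab
    simp only [if_true, Matrix.diagonal_apply_eq, Complex.ofReal_sum, Complex.ofReal_mul]
    refine Finset.sum_congr rfl fun l _ => ?_
    rw [Real.volume_real_Icc_of_le (hT (Fin.castSucc_le_succ l)), Complex.real_smul]
  · simp [hab]

/-! ### Cat states: Fisher information and entanglement -/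

/-- The equal superposition of two basis states. -/
def catState {d : ℕ} (o o' : Config d 0) : Ket d 0 :=
  Pi.single o ((√2)⁻¹ : ℂ) + Pi.single o' ((√2)⁻¹ : ℂ)

theorem sum_mul_normSq_catState {d : ℕ} {o o' : Config d 0} (hne : o ≠ o') (F : Config d 0 → ℝ) :
    ∑ c, F c * Complex.normSq (catState o o' c) = (F o + F o') / 2 := by
  have h : ∀ c, F c * Complex.normSq (catState o o' c) =
      (if c = o then F c / 2 else 0) + if c = o' then F c / 2 else 0 := by
    intro c
    have h2 : Complex.normSq ((√2 : ℝ) : ℂ)⁻¹ = 1 / 2 := by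
      rw [map_inv₀, Complex.normSq_ofReal, Real.mul_self_sqrt (by norm_num)]
      norm_num
    by_cases h1 : c = o
    · subst h1
      simp only [catState, Pi.add_apply, Pi.single_eq_same, Pi.single_eq_of_ne hne, if_true,
        if_neg hne, add_zero, h2]
      ring
    · by_cases h3 : c = o'
      · subst h3
        simp only [catState, Pi.add_apply, Pi.single_eq_same, Pi.single_eq_of_ne h1, if_true,
          if_neg h1, zero_add, h2]
        ring
      · simp [catState, h1, h3]
  simp only [h, Finset.sum_add_distrib, Finset.sum_ite_eq', Finset.mem_univ, if_true]
  ring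

theorem star_catState_dotProduct {d : ℕ} {o o' : Config d 0} (hne : o ≠ o') :
    star (catState o o') ⬝ᵥ catState o o' = 1 := by
  have h := sum_mul_normSq_catState hne 1
  have e : star (catState o o') ⬝ᵥ catState o o' =
      ((∑ c, (1 : Config d 0 → ℝ) c * Complex.normSq (catState o o' c) : ℝ) : ℂ) := by
    simp [dotProduct, Complex.normSq_eq_conj_mul_self]
  rw [e, h]
  simp

theorem re_dotProduct_diagonal_mulVec {d n : ℕ} (F G : Config d n → ℝ) (ψ : Ket d n) :
    (star ((Matrix.diagonal fun c => (F c : ℂ) : Op d n) *ᵥ ψ) ⬝ᵥ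
      ((Matrix.diagonal fun c => (G c : ℂ) : Op d n) *ᵥ ψ)).re =
      ∑ c, F c * G c * Complex.normSq (ψ c) := by
  simp only [dotProduct, Pi.star_apply, Matrix.mulVec_diagonal, Complex.re_sum]
  refine Finset.sum_congr rfl fun c _ => ?_
  simp only [Complex.normSq_apply, Complex.star_def, Complex.mul_re, Complex.mul_im,
    Complex.conj_re, Complex.conj_im, Complex.ofReal_re, Complex.ofReal_im]
  ring

theorem expectation_diagonal {d n : ℕ} (G : Config d n → ℝ) (ψ : Ket d n) :
    expectation ψ (Matrix.diagonal fun c => (G c : ℂ)) = ∑ c, G c * Complex.normSq (ψ c) := by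
  have h := re_dotProduct_diagonal_mulVec (fun _ => 1) G ψ
  simp only [Complex.ofReal_one, Matrix.diagonal_one, Matrix.one_mulVec, one_mul] at h
  exact h

/-- The Fisher information of a permutation protocol, with the equal superposition of two basis
states as the probe. -/
theorem fisher_permProtocol {d N : ℕ} {t : ℝ} {o o' : Config d 0} (hne : o ≠ o')
    {T : Fin (N + 2) → ℝ} {hT : Monotone T} {hT0 : T 0 = 0} {hTt : T (Fin.last (N + 1)) = t}
    {V : Fin (N + 1) → Equiv.Perm (Config d 0)} (f : Fin (N + 1) → ℝ → Config d 0 → ℝ)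
    (i j : Fin d) :
    (permProtocol (catState o o') (star_catState_dotProduct hne) T hT hT0 hTt V).fisher
        (fun l s => phasedPerm (f l s) (V l)) i j =
      (∑ l, (T l.succ - T l.castSucc) * ((spin i (V l o) - spin i (V l o')) / 2)) *
      ∑ l, (T l.succ - T l.castSucc) * ((spin j (V l o) - spin j (V l o')) / 2) := by
  rw [Protocol.fisher_eq_covariance, Protocol.covariance, integrated_phasedPerm,
    integrated_phasedPerm, re_dotProduct_diagonal_mulVec, expectation_diagonal,
    expectation_diagonal, sum_mul_normSq_catState hne,
    sum_mul_normSq_catState hne fun c => ∑ l, (T l.succ - T l.castSucc) * spin i (V l c),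
    sum_mul_normSq_catState hne fun c => ∑ l, (T l.succ - T l.castSucc) * spin j (V l c)]
  -- For two equally likely outcomes, `(F G + F' G') / 2 - (F + F') (G + G') / 4 = (F - F') (G - G')
  -- / 4`; hence the Fisher matrix has rank at most one.
  simp only [← mul_div_assoc, ← Finset.sum_div, mul_sub, Finset.sum_sub_distrib]
  ring

theorem phasedPerm_mulVec_catState {d : ℕ} (f : Config d 0 → ℝ) (V : Equiv.Perm (Config d 0))
    (o o' c : Config d 0) : ((phasedPerm f V : Op d 0) *ᵥ catState o o') c =
      (if c = V o then Complex.exp (-Complex.I * f o) * (√2 : ℂ)⁻¹ else 0) +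
      if c = V o' then Complex.exp (-Complex.I * f o') * (√2 : ℂ)⁻¹ else 0 := by
  rw [catState, Matrix.mulVec_add, Matrix.mulVec_single, Matrix.mulVec_single]
  simp [Matrix.col_apply, phasedPerm_apply]

/-- A superposition of two basis states that differ on the sensor qubits in `B` only. -/
theorem producible_of_two_basis_states {d k : ℕ} {o o' : Config d 0} {B : Finset (Fin d)}
    {i₀ : Fin d} (hi : i₀ ∈ B) (hB : B.card ≤ k) (ho : ∀ j, j ∉ B → o' (Sum.inl j) = o (Sum.inl j))
    {u v : ℂ} {ψ : Ket d 0}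
    (hψ : ∀ c, ψ c = (if c = o then u else 0) + (if c = o' then v else 0)) :
    Producible k ψ := by
  classical
  -- The set `B` forms the block labelled `i₀`, and each other qubit is a block of its own. Labels
  -- in `B` other than `i₀` belong to empty blocks, whose factor is `1`.
  let b : Fin d ⊕ Fin 0 → Fin d := Sum.elim (fun j => if j ∈ B then i₀ else j) Fin.elim0
  refine ⟨d, b, fun β f => if β = i₀ then (if ∀ q, f q = o q then u else 0) +
      (if ∀ q, f q = o' q then v else 0) else if ∀ q, f q = o q then 1 else 0, fun β => ?_,
      fun c => ?_⟩
  · by_cases hβ : β = i₀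
    · refine (Finset.card_le_card fun j hj => ?_).trans hB
      by_contra hjB
      have : j = β := by simpa [b, hjB] using (Finset.mem_filter.1 hj).2
      exact hjB (this ▸ hβ ▸ hi)
    · refine (Finset.card_le_card (t := {β}) fun j hj => ?_).trans
        ((Finset.card_singleton β).trans_le ((Finset.card_pos.2 ⟨i₀, hi⟩).trans_le hB))
      by_cases hjB : j ∈ B
      · have : i₀ = β := by simpa [b, hjB] using (Finset.mem_filter.1 hj).2
        exact absurd this.symm hβ
      · simpa [b, hjB] using (Finset.mem_filter.1 hj).2
  · rw [hψ, ← Finset.mul_prod_erase Finset.univ _ (Finset.mem_univ i₀)]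
    beta_reduce
    rw [if_pos rfl]
    have hblock : ∀ x : Config d 0, (∀ q : {q // b q = i₀}, c q = x q) ↔
        ∀ j ∈ B, c (Sum.inl j) = x (Sum.inl j) := by
      intro x
      constructor
      · intro h j hj
        exact h ⟨Sum.inl j, by simp [b, hj]⟩
      · rintro h ⟨q | q, hq⟩
        · by_cases hjB : q ∈ B
          · exact h q hjB
          · have : q = i₀ := by simpa [b, hjB] using hq
            exact absurd (this ▸ hi) hjB
        · exact q.elim0
    rw [Finset.prod_congr rfl fun β hβ => if_neg (Finset.ne_of_mem_erase hβ)]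
    by_cases hc : ∀ j, j ∉ B → c (Sum.inl j) = o (Sum.inl j)
    · rw [Finset.prod_eq_one, mul_one]
      · have heq : ∀ x : Config d 0, (∀ j, j ∉ B → x (Sum.inl j) = o (Sum.inl j)) →
            (c = x ↔ ∀ q : {q // b q = i₀}, c q = x q) := by
          intro x hx
          rw [hblock]
          constructor
          · rintro rfl j _; rfl
          · intro h
            ext1 q
            rcases q with j | j
            · by_cases hj : j ∈ B
              · exact h j hj
              · rw [hc j hj, hx j hj]
            · exact j.elim0
        simp only [heq o fun _ _ => rfl, heq o' ho]
      · intro β hβ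
        rw [if_pos]
        rintro ⟨q | q, hq⟩
        · refine hc q fun hqB => Finset.ne_of_mem_erase hβ ?_
          rw [← hq]; simp [b, hqB]
        · exact q.elim0
    -- If `c` differs from `o` at some `j` outside `B`, the factor of the singleton block `j` is
    -- zero, and `c` is neither `o` nor `o'`.
    · push Not at hc
      obtain ⟨j, hj, hcj⟩ := hc
      have hji : j ≠ i₀ := fun h => hj (h ▸ hi)
      rw [Finset.prod_eq_zero (i := j) (by simp [hji]), mul_zero,
        if_neg (fun h => hcj (by rw [h])), if_neg (fun h => hcj (by rw [h, ho j hj])), add_zero]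
      rw [if_neg]
      intro h
      exact hcj (h ⟨Sum.inl j, by simp [b, hj]⟩)

/-! ### Controlled flips and the optimal protocol -/

/-- Flip the sensor qubits in `B`, except `i₀`, if the qubit `i₀` differs from its value in `o`. -/
def controlledFlip {d : ℕ} (o : Config d 0) (i₀ : Fin d) (B : Finset (Fin d)) :
    Equiv.Perm (Config d 0) :=
  Function.Involutive.toPerm (fun c => Sum.elim (fun j =>
      if c (Sum.inl i₀) ≠ o (Sum.inl i₀) ∧ j ∈ B ∧ j ≠ i₀ then c (Sum.inl j) + 1
      else c (Sum.inl j)) Fin.elim0) <| by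
    intro c
    have h2 : ∀ x : Fin 2, x + 1 + 1 = x := by decide
    ext1 q
    rcases q with j | j
    · by_cases h : c (Sum.inl i₀) ≠ o (Sum.inl i₀) ∧ j ∈ B ∧ j ≠ i₀
      · simp [h.1, h.2.1, h.2.2, h2]
      · simp only [Sum.elim_inl, ne_eq, not_true_eq_false, and_false, if_false]
        simp only [ne_eq] at h
        rw [if_neg h, if_neg h]
    · exact j.elim0

theorem controlledFlip_apply {d : ℕ} (o : Config d 0) (i₀ : Fin d) (B : Finset (Fin d))
    (c : Config d 0) (j : Fin d) : controlledFlip o i₀ B c (Sum.inl j) =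
      if c (Sum.inl i₀) ≠ o (Sum.inl i₀) ∧ j ∈ B ∧ j ≠ i₀ then c (Sum.inl j) + 1
      else c (Sum.inl j) := rfl

theorem controlledFlip_singleton {d : ℕ} (o : Config d 0) (i₀ : Fin d) :
    controlledFlip o i₀ {i₀} = 1 := by
  ext1 c
  ext1 q
  rcases q with j | j
  · rw [controlledFlip_apply, if_neg (by simp)]
    rfl
  · exact j.elim0

theorem controlledFlip_self {d : ℕ} (o : Config d 0) (i₀ : Fin d) (B : Finset (Fin d)) :
    controlledFlip o i₀ B o = o := by
  ext1 q
  rcases q with j | j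
  · rw [controlledFlip_apply, if_neg (by simp)]
  · exact j.elim0

/-- Flip the sensor qubits in `B`. -/
def flipOn {d : ℕ} (o : Config d 0) (B : Finset (Fin d)) : Config d 0 :=
  Sum.elim (fun j => if j ∈ B then o (Sum.inl j) + 1 else o (Sum.inl j)) Fin.elim0

/-- Together with `controlledFlip_self`, this turns the cat state on `{i₀}` into the one on `B`:
only the branch in which `i₀` is flipped triggers the other flips. -/
theorem controlledFlip_flipOn {d : ℕ} (o : Config d 0) {i₀ : Fin d} {B : Finset (Fin d)}
    (hi : i₀ ∈ B) : controlledFlip o i₀ B (flipOn o {i₀}) = flipOn o B := by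
  have h2 : ∀ x : Fin 2, x + 1 ≠ x := by decide
  ext1 q
  rcases q with j | j
  · rw [controlledFlip_apply]
    by_cases hj : j = i₀
    · subst hj; simp [flipOn, hi]
    · simp [flipOn, hj, h2]
  · exact j.elim0

theorem spin_flipOn {d : ℕ} (o : Config d 0) (B : Finset (Fin d)) (j : Fin d) :
    (spin j o - spin j (flipOn o B)) / 2 = if j ∈ B then spin j o else 0 := by
  have h2 : ∀ x : Fin 2, x + 1 = 0 ↔ x ≠ 0 := by decide
  by_cases hj : j ∈ B
  · by_cases ho : o (Sum.inl j) = 0 <;> simp [spin, flipOn, hj, h2, ho]; norm_num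
  · simp [spin, flipOn, hj]

/-- A protocol that switches between cat states, optimal for every value of the parameters. -/
theorem exists_optimal_protocol {d k : ℕ} {α : Fin d → ℝ} (hk : 0 < k) (hα : 0 < ‖α‖)
    (hupper : (∑ j, |α j|) / ‖α‖ ≤ k) {t : ℝ} (ht : 0 < t) :
    ∃ P : Protocol d t, P.numAncilla = 0 ∧
      ∀ θ : Fin d → ℝ, ∃ U : Fin (P.numGates + 1) → ℝ → UnitaryOp d P.numAncilla,
        P.IsEvolution θ U ∧ P.IsOptimal α U ∧ P.EntanglementAtMost k U := by
  have hne : Nonempty (Fin d) := by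
    by_contra h
    rw [not_nonempty_iff] at h
    simp [Subsingleton.elim α 0] at hα
  obtain ⟨i₀, hi₀⟩ : ∃ i, |α i| = ‖α‖ := by
    obtain ⟨i, hi⟩ := Finite.exists_max fun i => |α i|
    refine ⟨i, le_antisymm (by simpa using norm_le_pi_norm α i) ?_⟩
    exact (pi_norm_le_iff_of_nonneg (abs_nonneg _)).2 fun j => by simpa using hi j
  obtain ⟨n, B, μ, hB0, hBi, hBk, hμ0, hμ1, hμB⟩ := exists_schedule (a := fun j => |α j| / ‖α‖) hk
    (fun j => by positivity)
    (fun j => (div_le_one hα).2 (by simpa using norm_le_pi_norm α j))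
    (by rwa [← Finset.sum_div]) (i₀ := i₀) (by rw [hi₀, div_self hα.ne'])
  -- The reference state aligns the spin of each qubit with the sign of `α j`, so that active qubits
  -- accumulate with the correct sign.
  let o : Config d 0 := Sum.elim (fun j => if 0 ≤ α j then 0 else 1) Fin.elim0
  have ho : ∀ j, spin j o * |α j| = α j := by
    intro j
    by_cases h : 0 ≤ α j
    · simp [spin, o, h, abs_of_nonneg h]
    · simp [spin, o, h, abs_of_neg (not_le.1 h)]
  have hoo : o ≠ flipOn o {i₀} := by
    have h2 : ∀ x : Fin 2, x ≠ x + 1 := by decide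
    intro h
    exact h2 (o (Sum.inl i₀)) ((congrFun h (Sum.inl i₀)).trans (by simp [flipOn]))
  -- Partial sums of the fractions; the strict inequality gives `T 0 = 0` and makes segment `l` last
  -- `t * μ l`.
  let T : Fin (n + 2) → ℝ := fun l => t * ∑ i : Fin (n + 1), if i.castSucc < l then μ i else 0
  have hT : Monotone T := by
    intro l l' hl
    refine mul_le_mul_of_nonneg_left (Finset.sum_le_sum fun i _ => ?_) ht.le
    by_cases h : i.castSucc < l
    · rw [if_pos h, if_pos (h.trans_le hl)]
    · rw [if_neg h]
      split_ifs
      · exact hμ0 i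
      · exact le_rfl
  have hT0 : T 0 = 0 := by simp [T]
  have hTt : T (Fin.last (n + 1)) = t := by simp [T, Fin.castSucc_lt_last, hμ1]
  have hTd : ∀ l : Fin (n + 1), T l.succ - T l.castSucc = t * μ l := by
    intro l
    have h : ∀ i : Fin (n + 1), ((if i.castSucc < l.succ then μ i else 0) -
        if i.castSucc < l.castSucc then μ i else 0) = if i = l then μ i else 0 := by
      intro i
      simp only [Fin.lt_def, Fin.ext_iff, Fin.val_succ, Fin.val_castSucc]
      split_ifs <;> first | omega | simp
    simp only [T]
    rw [← mul_sub, ← Finset.sum_sub_distrib]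
    simp only [h, Finset.sum_ite_eq', Finset.mem_univ, if_true]
  let V : Fin (n + 1) → Equiv.Perm (Config d 0) := fun l => controlledFlip o i₀ (B l)
  have hV0 : V 0 = 1 := by
    simp only [V, hB0, controlledFlip_singleton]
  have hVo : ∀ l, V l o = o := fun l => controlledFlip_self o i₀ (B l)
  have hVo' : ∀ l, V l (flipOn o {i₀}) = flipOn o (B l) := fun l =>
    controlledFlip_flipOn o (hBi l)
  -- The qubit `j` is active during a fraction `|α j| / ‖α‖` of the time, and contributes nothing
  -- otherwise.
  have hsum : ∀ j, ∑ l, (T l.succ - T l.castSucc) *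
      ((spin j (V l o) - spin j (V l (flipOn o {i₀}))) / 2) = t / ‖α‖ * α j := by
    intro j
    simp only [hVo, hVo', spin_flipOn, hTd]
    calc ∑ l, t * μ l * (if j ∈ B l then spin j o else 0)
        = t * spin j o * ∑ l, (if j ∈ B l then μ l else 0) := by
          rw [Finset.mul_sum]
          refine Finset.sum_congr rfl fun l _ => ?_
          split_ifs <;> ring
      _ = t / ‖α‖ * (spin j o * |α j|) := by rw [hμB]; ring
      _ = t / ‖α‖ * α j := by rw [ho]
  refine ⟨permProtocol (catState o (flipOn o {i₀})) (star_catState_dotProduct hoo) T hT hT0 hTt V,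
    rfl, fun θ => ⟨fun l s => phasedPerm (phase T V θ l s) (V l), isEvolution_permProtocol hV0 θ,
      ⟨Pi.single i₀ 1, fun i => ?_, fun i hi => ?_, by simp, fun j => ?_⟩, fun l s _ => ?_⟩⟩
  · by_cases hi : i = i₀
    · subst hi; simp
    · simp [hi]
  · have : i ≠ i₀ := fun e => hi (by rw [e, hi₀])
    simp [this]
  · rw [Finset.sum_eq_single i₀ (fun i _ hi => by simp [hi]) (by simp), fisher_permProtocol hoo,
      hsum, hsum, Pi.single_eq_same, one_mul]
    have hs : Real.sign (α i₀) * α i₀ = ‖α‖ := by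
      rw [← hi₀]
      rcases lt_trichotomy (α i₀) 0 with h | h | h
      · rw [Real.sign_of_neg h, abs_of_neg h]; ring
      · simp [h]
      · rw [Real.sign_of_pos h, abs_of_pos h]; ring
    calc Real.sign (α i₀) * (t / ‖α‖ * α j * (t / ‖α‖ * α i₀))
        = t / ‖α‖ * α j * (t / ‖α‖) * (Real.sign (α i₀) * α i₀) := by ring
      _ = t ^ 2 / ‖α‖ * α j := by rw [hs]; field_simp
  · refine producible_of_two_basis_states (o := o) (o' := flipOn o (B l)) (hBi l) (hBk l)
      (fun j hj => by simp [flipOn, hj])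
      (u := Complex.exp (-Complex.I * phase T V θ l s o) * (√2 : ℂ)⁻¹)
      (v := Complex.exp (-Complex.I * phase T V θ l s (flipOn o {i₀})) * (√2 : ℂ)⁻¹) fun c => ?_
    exact (phasedPerm_mulVec_catState _ (V l) o _ c).trans (by rw [hVo, hVo'])

end SensorNetwork

end

theorem theorem1 (d : ℕ) (α : Fin d → ℝ) (k : ℕ) (hk : 0 < k)
    (hlower : (k : ℝ) - 1 < (∑ j, |α j|) / ‖α‖) (hupper : (∑ j, |α j|) / ‖α‖ ≤ (k : ℝ))
    (t : ℝ) (ht : 0 < t) :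
    (∀ (P : SensorNetwork.Protocol d t) (θ : Fin d → ℝ)
      (U : Fin (P.numGates + 1) → ℝ → SensorNetwork.UnitaryOp d P.numAncilla) (m : ℕ),
      P.IsEvolution θ U → P.IsOptimal α U → P.EntanglementAtMostAE m U → k ≤ m) ∧
    (∃ P : SensorNetwork.Protocol d t, P.numAncilla = 0 ∧
      ∀ θ : Fin d → ℝ, ∃ U : Fin (P.numGates + 1) → ℝ → SensorNetwork.UnitaryOp d P.numAncilla,
        P.IsEvolution θ U ∧ P.IsOptimal α U ∧ P.EntanglementAtMost k U) := by
  have hα : 0 < ‖α‖ := by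
    refine (norm_nonneg α).lt_of_ne fun h => ?_
    -- For `α = 0` the quotient is `0` by the convention on division, which contradicts `k - 1 ≥ 0`.
    rw [← h, div_zero] at hlower
    have : (1 : ℝ) ≤ k := by exact_mod_cast hk
    linarith
  refine ⟨fun P θ U m hev hopt hm => ?_, SensorNetwork.exists_optimal_protocol hk hα hupper ht⟩
  have h := SensorNetwork.Protocol.sum_abs_le_of_isOptimal ht hα hev.continuousOn hopt hm
  -- Now `k - 1 < ‖α‖₁ / ‖α‖∞ ≤ m`, and integrality gives `k ≤ m`.
  have h2 : (k : ℝ) < m + 1 := by linarith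
  have h3 : k < m + 1 := by exact_mod_cast h2
  omega
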